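/- Let $K$ be a field of characteristic $\neq 2$ and let $n$ be a positive integer. A field extension $M/K$ (not necessarily algebraic) is called a PAC extension (in the sense of Jarden and Razon) if for every absolutely irreducible polynomial $f(X,Y)\in M[X,Y]$ that is separable in $Y$ (i.e. $\frac{\partial f}{\partial Y}\neq 0$) there are infinitely many $(x,y)\in K\times M$ with $f(x,y)=0$. Suppose that $K$ has a PAC extension $M/K$ such that $M$ has a (finite) separable field extension of degree $n$. Then every non-degenerate quadratic form of dimension $n$ over $K$ is isomorphic to a scaled trace form, that is, to a quadratic form $$x\mapsto \mathrm{Tr}_{F/K}(\alpha x^2),\qquad x\in F,$$ on the $K$-vector space $F$, where $F/K$ is a finite separable field extension and $\alpha\in F$ is nonzero. -/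

import Mathlib

universe u v w x

open Polynomial
open scoped Polynomial.Bivariate

/-- A bivariate polynomial `f(X, Y)` over a field `M` is absolutely irreducible if it is
irreducible as a polynomial in two variables over an algebraic closure of `M`. -/
def IsAbsolutelyIrreducible {M : Type v} [Field M] (f : M[X][Y]) : Prop :=
  Irreducible (f.map (mapRingHom (algebraMap M (AlgebraicClosure M))))

/-- A field extension `M / K` (not necessarily algebraic) is a PAC extension if every absolutely
irreducible `f(X, Y)` over `M` that is separable in `Y`, that is `∂f/∂Y ≠ 0`, has infinitely many
zeros `(x, y)` in `K × M`. In `M[X][Y]` the outer variable is `Y`, so `derivative` is `∂/∂Y`, and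
`f.evalEval a b` is `f(a, b)` with `X = a` and `Y = b`. -/
def IsPACExtension (K : Type u) (M : Type v) [Field K] [Field M] [Algebra K M] : Prop :=
  ∀ f : M[X][Y], IsAbsolutelyIrreducible f → derivative f ≠ 0 →
    {p : K × M | f.evalEval (algebraMap K M p.1) p.2 = 0}.Infinite

/-- The quadratic form `x ↦ Tr_{F/K} (α x²)` on the `K`-vector space `F`. -/
noncomputable def scaledTraceForm (K : Type u) (F : Type w) [Field K] [Field F] [Algebra K F]
    (α : F) : QuadraticForm K F :=
  LinearMap.BilinMap.toQuadraticMap (Algebra.traceForm K F ∘ₗ LinearMap.mulLeft K α)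

theorem scaledTraceForm_apply (K : Type u) (F : Type w) [Field K] [Field F] [Algebra K F]
    (α y : F) : scaledTraceForm K F α y = Algebra.trace K F (α * y ^ 2) := by
  simp [scaledTraceForm, Algebra.traceForm_apply, pow_two, mul_assoc]

/-- A quadratic form over `K` is isomorphic to a scaled trace form if it is isometric to
`x ↦ Tr_{F/K} (α x²)` for a finite separable field extension `F / K` and a nonzero `α ∈ F`. -/
def IsIsomorphicToScaledTraceForm {K : Type u} {V : Type x} [Field K] [AddCommGroup V]
    [Module K V] (Q : QuadraticForm K V) : Prop :=
  ∃ (F : Type u) (_ : Field F) (_ : Algebra K F),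
    FiniteDimensional K F ∧ Algebra.IsSeparable K F ∧
      ∃ α : F, α ≠ 0 ∧ QuadraticMap.Equivalent Q (scaledTraceForm K F α)

/-! Diagonalize the form as ⟨a_1, …, a_n⟩. If an operator T, self-adjoint for the form, has
irreducible separable characteristic polynomial, then V is a line over the field F = K[T]. For v ≠ 0
one gets Q(xv) = ℓ(x²) with ℓ linear on F, and nondegeneracy of the trace form gives ℓ = Tr(α ·). It
remains to find T, which is sought among the matrices diag(λ) + t a⁻¹ w wᵀ; these are self-adjoint
for all λ, w, t over K.

Let f_t be the characteristic polynomial; irreducibility over M is enough. Let N/M be separable of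
degree n, E an algebraic closure of M and δ ∈ N. Index the roots x_φ of a monic f by the embeddings
φ : N → E. The resolvent ∏_σ (U - ∑_φ φ(δ) x_{σφ}) has coefficients in M. If it is separable with a
root in M, then Galois permutes the roots of f as it permutes the embeddings, hence transitively,
and f is irreducible (`irreducible_of_specialize_root`). For f = f_t the resolvent is a polynomial
in (t, U), and the PAC property supplies a zero in K × M once it is absolutely irreducible.

Absolute irreducibility is an open condition on (λ, w) (`exists_eval_ne_zero_imp_irreducible`) and K
is infinite, so one good point over E suffices. For n ≥ 2, suitable λ, w make f_t equal to g(Y) - (τ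
+ t)Y with g = (Y - 1)² m. Its Galois group over E(t) is 2-transitive and contains a transposition,
so it is S_n (`exists_algEquiv_perm_roots`), and S_n permutes the n! roots of the resolvent
transitively. -/

namespace PACTrace

/-! ### Permutation groups and irreducibility through conjugate roots -/

/-- Conjugating (a b) by the stabilizer of a yields every (a y), and (y z) is the conjugate of (a z)
by (a y). -/
theorem subgroup_eq_top_of_swap_mem {ι : Type*} [Finite ι] [DecidableEq ι]
    (H : Subgroup (Equiv.Perm ι)) {a b : ι} (hab : Equiv.swap a b ∈ H)
    (h : ∀ y, y ≠ a → ∃ g ∈ H, g a = a ∧ g b = y) : H = ⊤ := by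
  have h1 : ∀ y, Equiv.swap a y ∈ H := by
    intro y
    by_cases hy : y = a
    · subst hy; rw [Equiv.swap_self]; exact H.one_mem
    obtain ⟨g, hg, ga, gb⟩ := h y hy
    have := H.mul_mem (H.mul_mem hg hab) (H.inv_mem hg)
    rwa [← Equiv.swap_apply_apply, ga, gb] at this
  rw [eq_top_iff, ← Equiv.Perm.closure_isSwap, Subgroup.closure_le]
  rintro _ ⟨y, z, hyz, rfl⟩
  by_cases hy : y = a
  · subst hy; exact h1 z
  by_cases hz : z = a
  · subst hz; rw [Equiv.swap_comm]; exact h1 y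
  have := H.mul_mem (H.mul_mem (h1 y) (h1 z)) (H.inv_mem (h1 y))
  rwa [← Equiv.swap_apply_apply, Equiv.swap_apply_left,
    Equiv.swap_apply_of_ne_of_ne hz (Ne.symm hyz), Equiv.swap_comm, Equiv.swap_comm, ] at this

/-- A monic factor with one of the roots has all their conjugates as roots, hence has full degree.
The base is only a domain, so that polynomials in two variables are covered. -/
theorem irreducible_of_conjugate_roots {R Ω ι : Type*} [CommRing R] [IsDomain R] [Field Ω]
    [Fintype ι] [Nonempty ι] (θ : R →+* Ω) {p : R[X]} (hp : p.Monic) (r : ι → Ω)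
    (hr : Function.Injective r) (hpr : p.map θ = ∏ i, (X - C (r i)))
    (h : ∀ i j, ∃ γ : Ω →+* Ω, γ.comp θ = θ ∧ γ (r i) = r j) : Irreducible p := by
  classical
  have hdeg : p.natDegree = Fintype.card ι := by
    rw [← hp.natDegree_map θ, hpr, natDegree_finsetProd_X_sub_C_eq_card, Finset.card_univ]
  have key : ∀ f : R[X], f.Monic → ∀ i, (f.map θ).eval (r i) = 0 →
      Fintype.card ι ≤ f.natDegree := by
    intro f hf i hi
    have hroot : ∀ j, (f.map θ).eval (r j) = 0 := by
      intro j
      obtain ⟨γ, hγ, hγr⟩ := h i j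
      have := congrArg γ hi
      rwa [← eval_map_apply, hγr, map_map, hγ, map_zero] at this
    have hdvd : ∏ i, (X - C (r i)) ∣ f.map θ := by
      apply Finset.prod_dvd_of_coprime
      · intro i _ j _ hij
        exact pairwise_coprime_X_sub_C hr hij
      · intro j _
        exact dvd_iff_isRoot.2 (hroot j)
    have := natDegree_le_of_dvd hdvd (hf.map θ).ne_zero
    rwa [natDegree_finsetProd_X_sub_C_eq_card, Finset.card_univ, hf.natDegree_map] at this
  rw [hp.irreducible_iff_natDegree]
  refine ⟨?_, ?_⟩
  · rintro rfl
    have := Fintype.card_pos (α := ι)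
    rw [natDegree_one] at hdeg
    omega
  · intro f g hf hg hfg
    obtain ⟨i⟩ := ‹Nonempty ι›
    have h0 : (f.map θ).eval (r i) * (g.map θ).eval (r i) = 0 := by
      rw [← eval_mul, ← Polynomial.map_mul, hfg, hpr, eval_prod]
      exact Finset.prod_eq_zero (Finset.mem_univ i) (by simp)
    have hsum : f.natDegree + g.natDegree = Fintype.card ι := by
      rw [← hf.natDegree_mul hg, hfg, hdeg]
    rcases mul_eq_zero.1 h0 with h0 | h0
    · have := key f hf i h0; right; omega
    · have := key g hg i h0; left; omega

/-- If `f = ∏ (X - y_φ)` over the embeddings `φ` of `N`, and the resolvent value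
`∑ φ(δ) y_φ` is rational and distinct from its permuted versions, then the Galois group permutes the
roots as it permutes the embeddings. -/
theorem irreducible_of_rational_resolvent {M N E : Type*} [Field M] [Field N] [Algebra M N]
    [Field E] [Algebra M E] [IsAlgClosed E] [Algebra.IsAlgebraic M E] [Fintype (N →ₐ[M] E)]
    [Nonempty (N →ₐ[M] E)] {f : M[X]} (hf : f.Monic) (δ : N) (y : (N →ₐ[M] E) → E)
    (hy : Function.Injective y) (hfy : f.map (algebraMap M E) = ∏ φ, (X - C (y φ)))
    (hinj : Function.Injective fun σ : Equiv.Perm (N →ₐ[M] E) => ∑ φ, φ δ * y (σ φ))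
    {u : M} (hu : algebraMap M E u = ∑ φ, φ δ * y φ) : Irreducible f := by
  classical
  have hrange : ∀ (γ : E ≃ₐ[M] E) φ, ∃ ψ, y ψ = γ (y φ) := by
    intro γ φ
    have h0 : (f.map (algebraMap M E)).eval (γ (y φ)) = 0 := by
      have h1 : (f.map (algebraMap M E)).eval (y φ) = 0 := by
        rw [hfy, eval_prod]; exact Finset.prod_eq_zero (Finset.mem_univ φ) (by simp)
      rw [eval_map_algebraMap] at h1 ⊢
      rw [← AlgEquiv.coe_toAlgHom, aeval_algHom_apply, h1, map_zero]
    rw [hfy, eval_prod, Finset.prod_eq_zero_iff] at h0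
    obtain ⟨ψ, -, h⟩ := h0
    rw [eval_sub, eval_X, eval_C, sub_eq_zero] at h
    exact ⟨ψ, h.symm⟩
  have hact : ∀ (γ : E ≃ₐ[M] E) φ, γ (y φ) = y (γ.toAlgHom.comp φ) := by
    intro γ
    choose π hπ using hrange γ
    have hπinj : Function.Injective π := by
      intro a b hab
      have := hπ a
      rw [hab, hπ b] at this
      exact (hy (γ.injective this)).symm
    let π' : Equiv.Perm (N →ₐ[M] E) :=
      Equiv.ofBijective π (Finite.injective_iff_bijective.1 hπinj)
    let ρ : Equiv.Perm (N →ₐ[M] E) := (AlgEquiv.refl (R := M) (A₁ := N)).arrowCongr γ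
    have hρ : ∀ φ, ρ φ = γ.toAlgHom.comp φ := fun φ => by ext; simp [ρ]
    -- Applying γ to the rational value u and reindexing by ρ shows that π'ρ⁻¹ and 1 give the same
    -- resolvent value; injectivity then forces π' = ρ.
    have h1 : ∑ φ, φ δ * y ((π' * ρ⁻¹) φ) = ∑ φ, φ δ * y ((1 : Equiv.Perm (N →ₐ[M] E)) φ) := by
      have h2 := congrArg γ hu
      rw [γ.commutes, hu, map_sum] at h2
      rw [← Equiv.sum_comp ρ]
      simp only [Equiv.Perm.mul_apply, Equiv.Perm.coe_inv, Equiv.symm_apply_apply, Equiv.Perm.one_apply]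
      rw [h2]
      refine Finset.sum_congr rfl fun φ _ => ?_
      rw [map_mul, ← hπ φ, hρ]
      rfl
    have h3 := hinj h1
    intro φ
    rw [← hπ φ, ← hρ]
    have h4 : π' = ρ := by rwa [mul_inv_eq_one] at h3
    exact congrArg y (DFunLike.congr_fun h4 φ)
  refine irreducible_of_conjugate_roots (algebraMap M E) hf y hy hfy fun φ ψ => ?_
  -- With E viewed as an extension of N through φ, the embedding ψ extends to an endomorphism of E,
  -- bijective because E/M is algebraic.
  obtain ⟨γ, hγ⟩ : ∃ γ : E ≃ₐ[M] E, γ.toAlgHom.comp φ = ψ := by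
    let := φ.toRingHom.toAlgebra
    have : IsScalarTower M N E := IsScalarTower.of_algebraMap_eq fun x => (φ.commutes x).symm
    have : Algebra.IsAlgebraic N E := Algebra.IsAlgebraic.tower_top (K := M) N
    obtain ⟨γ, hγ⟩ := IsAlgClosed.surjective_domRestrict_of_isAlgebraic
      (K := M) (L := N) (M := E) (E := E) ψ
    exact ⟨AlgEquiv.ofBijective γ (Algebra.IsAlgebraic.algHom_bijective γ), hγ⟩
  exact ⟨γ.toRingEquiv.toRingHom, by ext x; simp, by rw [← hγ, ← hact]; rfl⟩

/-! ### Openness of absolute irreducibility -/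

theorem coeff_coeff_swap {R : Type*} [CommRing R] (p : R[X][Y]) (i j : ℕ) :
    ((Bivariate.swap p).coeff i).coeff j = (p.coeff j).coeff i := by
  induction p using Polynomial.induction_on' with
  | add p q hp hq => simp [hp, hq]
  | monomial n f =>
    induction f using Polynomial.induction_on' with
    | add f g hf hg => simp only [map_add, coeff_add, hf, hg]
    | monomial m a =>
      rw [Bivariate.swap_monomial_monomial]
      simp only [coeff_monomial]
      split_ifs <;> simp_all [coeff_monomial]

/-- The degree in the inner variable of a factor is at most that of the product. -/
theorem natDegree_coeff_le_of_mul_eq {R : Type*} [CommRing R] [IsDomain R] {p q r : R[X][Y]}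
    (hr : r ≠ 0) (h : p * q = r) {D : ℕ} (hD : ∀ i, (r.coeff i).natDegree ≤ D) (i : ℕ) :
    (p.coeff i).natDegree ≤ D := by
  -- After swapping the variables, the bound concerns a single degree, which is additive over a
  -- domain.
  have hle : ∀ s : R[X][Y], (∀ i, (s.coeff i).natDegree ≤ D) ↔ (Bivariate.swap s).natDegree ≤ D := by
    intro s
    rw [natDegree_le_iff_coeff_eq_zero]
    simp_rw [natDegree_le_iff_coeff_eq_zero]
    constructor
    · intro h N hN
      ext j
      rw [coeff_coeff_swap, h j N hN, coeff_zero]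
    · intro h i N hN
      rw [← coeff_coeff_swap, h N hN, coeff_zero]
  refine (hle p).2 ?_ i
  have hs : Bivariate.swap p * Bivariate.swap q = Bivariate.swap r := by rw [← map_mul, h]
  have hr' : Bivariate.swap r ≠ 0 := by
    simpa using hr
  rw [← hs] at hr'
  have := (hle r).1 hD
  rw [← hs, natDegree_mul (left_ne_zero_of_mul hr') (right_ne_zero_of_mul hr')] at this
  omega

/-- An extension of a point of the base along an integral extension. -/
theorem exists_ringHom_of_isIntegral {A C k : Type*} [CommRing A] [CommRing C] [Algebra A C]
    [Algebra.IsIntegral A C] [Field k] [IsAlgClosed k] (φ : A →+* k) (hφ : Function.Surjective φ)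
    (hker : RingHom.ker (algebraMap A C) ≤ RingHom.ker φ) :
    ∃ ψ : C →+* k, ψ.comp (algebraMap A C) = φ := by
  have : (RingHom.ker φ).IsMaximal := RingHom.ker_isMaximal_of_surjective φ hφ
  -- Lying over: the residue ring at Q is integral over the algebraically closed field k, hence
  -- equal to it.
  obtain ⟨Q, hQ, hQc⟩ := Ideal.exists_ideal_over_maximal_of_isIntegral (S := C) _ hker
  let φ' : k →+* C ⧸ Q := (Ideal.quotientMap Q (algebraMap A C) hQc.ge).comp
    (RingHom.quotientKerEquivOfSurjective hφ).symm.toRingHom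
  have hφ' : ∀ a, φ' (φ a) = Ideal.Quotient.mk Q (algebraMap A C a) := by
    intro a
    have : (RingHom.quotientKerEquivOfSurjective hφ).symm (φ a) = Ideal.Quotient.mk _ a := by
      rw [RingEquiv.symm_apply_eq]; rfl
    simp only [φ', RingHom.comp_apply, RingEquiv.toRingHom_eq_coe, RingHom.coe_coe, this]
    rfl
  let := φ'.toAlgebra
  have : Algebra.IsIntegral k (C ⧸ Q) := by
    refine ⟨fun x => ?_⟩
    obtain ⟨c, rfl⟩ := Ideal.Quotient.mk_surjective x
    obtain ⟨p, hp, hpc⟩ := Algebra.IsIntegral.isIntegral (R := A) c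
    refine ⟨p.map φ, hp.map φ, ?_⟩
    rw [eval₂_map]
    have : (algebraMap k (C ⧸ Q)).comp φ = (Ideal.Quotient.mk Q).comp (algebraMap A C) :=
      RingHom.ext hφ'
    rw [this, ← hom_eval₂, hpc, map_zero]
  have hbij := IsAlgClosed.algebraMap_bijective_of_isIntegral (k := k) (K := C ⧸ Q)
  let e := RingEquiv.ofBijective (algebraMap k (C ⧸ Q)) hbij
  refine ⟨e.symm.toRingHom.comp (Ideal.Quotient.mk Q), RingHom.ext fun a => ?_⟩
  simp only [RingHom.comp_apply, RingEquiv.toRingHom_eq_coe, RingHom.coe_coe]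
  rw [RingEquiv.symm_apply_eq]
  exact (hφ' a).symm

/-- The monic polynomial in `Y` of degree `d`, of degree at most `D` in `X`, with given
coefficients. -/
noncomputable def monicOfCoeffs {R : Type*} [CommRing R] (d D : ℕ)
    (c : Fin d × Fin (D + 1) → R) : R[X][Y] :=
  X ^ d + ∑ i : Fin d, C (∑ j : Fin (D + 1), C (c (i, j)) * X ^ (j : ℕ)) * X ^ (i : ℕ)

section monicOfCoeffs

variable {R : Type*} [CommRing R] {d D : ℕ} (c : Fin d × Fin (D + 1) → R)

theorem monic_monicOfCoeffs : (monicOfCoeffs d D c).Monic :=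
  monic_X_pow_add (degree_sum_fin_lt _)

theorem natDegree_monicOfCoeffs [Nontrivial R] : (monicOfCoeffs d D c).natDegree = d := by
  rw [monicOfCoeffs, natDegree_add_eq_left_of_degree_lt, natDegree_X_pow]
  rw [degree_X_pow]; exact degree_sum_fin_lt _

theorem map_monicOfCoeffs {S : Type*} [CommRing S] (f : R →+* S) :
    (monicOfCoeffs d D c).map (mapRingHom f) = monicOfCoeffs d D (f ∘ c) := by
  simp [monicOfCoeffs, Polynomial.map_sum]

theorem coeff_coeff_monicOfCoeffs (i : Fin d) (j : Fin (D + 1)) :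
    ((monicOfCoeffs d D c).coeff i).coeff j = c (i, j) := by
  have h1 : ∀ {S : Type _} [CommRing S] {m : ℕ} (a : Fin m → S) (i : Fin m),
      (∑ i : Fin m, C (a i) * X ^ (i : ℕ)).coeff i = a i := by
    intro S _ m a i
    rw [finsetSum_coeff, Finset.sum_eq_single i]
    · simp
    · intro b _ hb
      simp [coeff_X_pow, Fin.val_inj, hb.symm]
    · simp
  rw [monicOfCoeffs, coeff_add, coeff_X_pow, if_neg i.2.ne, zero_add, h1, h1]

theorem eq_monicOfCoeffs {p : R[X][Y]} (hp : p.Monic) (hd : p.natDegree = d)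
    (hD : ∀ i, (p.coeff i).natDegree ≤ D) :
    p = monicOfCoeffs d D fun ij => (p.coeff ij.1).coeff ij.2 := by
  conv_lhs => rw [hp.as_sum]
  rw [monicOfCoeffs, hd, Finset.sum_range]
  congr 2 with i
  congr 2
  conv_lhs => rw [as_sum_range_C_mul_X_pow' (p.coeff i) (Nat.lt_succ_of_le (hD i))]
  rw [Finset.sum_range]

end monicOfCoeffs

section Openness

attribute [local instance] Polynomial.algebra

/-- Coefficients of a monic factor of a monic polynomial are integral, first over A[X]; a polynomial
integral over A[X] then has coefficients integral over A. -/
theorem isIntegral_coeff_coeff_of_dvd {A Q : Type*} [CommRing A] [CommRing Q] [Algebra A Q]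
    {P : A[X][Y]} (hP : P.Monic) {F : Q[X][Y]} (hF : F.Monic)
    (h : F ∣ P.map (mapRingHom (algebraMap A Q))) (i j : ℕ) :
    IsIntegral A ((F.coeff i).coeff j) :=
  (isIntegral_coeff_of_dvd P F hP hF h i).coeff j

/-- The universal ring over which a monic polynomial factors into monic factors of prescribed
degrees is integral over the base. -/
theorem exists_universal_factorization {A : Type*} [CommRing A] {P : A[X][Y]} (hP : P.Monic)
    (d e D : ℕ) : ∃ (J : Ideal (MvPolynomial ((Fin d × Fin (D + 1)) ⊕ (Fin e × Fin (D + 1))) A)),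
      Algebra.IsIntegral A (MvPolynomial ((Fin d × Fin (D + 1)) ⊕ (Fin e × Fin (D + 1))) A ⧸ J) ∧
      (∃ a b, monicOfCoeffs d D a * monicOfCoeffs e D b = P.map (mapRingHom (algebraMap A
        (MvPolynomial ((Fin d × Fin (D + 1)) ⊕ (Fin e × Fin (D + 1))) A ⧸ J)))) ∧
      ∀ {k : Type _} [CommRing k] (φ : A →+* k) (a : Fin d × Fin (D + 1) → k)
        (b : Fin e × Fin (D + 1) → k),
        monicOfCoeffs d D a * monicOfCoeffs e D b = P.map (mapRingHom φ) →
        RingHom.ker (algebraMap A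
        (MvPolynomial ((Fin d × Fin (D + 1)) ⊕ (Fin e × Fin (D + 1))) A ⧸ J)) ≤ RingHom.ker φ := by
  set B := MvPolynomial ((Fin d × Fin (D + 1)) ⊕ (Fin e × Fin (D + 1))) A with hB
  obtain ⟨Fu, hFu⟩ : ∃ Fu : B[X][Y],
    Fu = monicOfCoeffs d D fun ij => MvPolynomial.X (Sum.inl ij) := ⟨_, rfl⟩
  obtain ⟨Gu, hGu⟩ : ∃ Gu : B[X][Y],
    Gu = monicOfCoeffs e D fun ij => MvPolynomial.X (Sum.inr ij) := ⟨_, rfl⟩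
  obtain ⟨H, hH⟩ : ∃ H : B[X][Y], H = Fu * Gu - P.map (mapRingHom (algebraMap A B)) := ⟨_, rfl⟩
  obtain ⟨J, hJ⟩ : ∃ J : Ideal B, J = Ideal.span {c | ∃ i j, c = (H.coeff i).coeff j} := ⟨_, rfl⟩
  have hFm : Fu.map (mapRingHom (Ideal.Quotient.mk J)) = monicOfCoeffs d D
      fun ij => Ideal.Quotient.mk J (MvPolynomial.X (Sum.inl ij)) := by
    rw [hFu, map_monicOfCoeffs]; rfl
  have hGm : Gu.map (mapRingHom (Ideal.Quotient.mk J)) = monicOfCoeffs e D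
      fun ij => Ideal.Quotient.mk J (MvPolynomial.X (Sum.inr ij)) := by
    rw [hGu, map_monicOfCoeffs]; rfl
  have hFG : Fu.map (mapRingHom (Ideal.Quotient.mk J)) * Gu.map (mapRingHom (Ideal.Quotient.mk J)) =
      P.map (mapRingHom (algebraMap A (B ⧸ J))) := by
    have hH0 : H.map (mapRingHom (Ideal.Quotient.mk J)) = 0 := by
      ext i j
      simp only [coeff_map, coe_mapRingHom, coeff_zero]
      exact Ideal.Quotient.eq_zero_iff_mem.2 (hJ ▸ Ideal.subset_span ⟨i, j, rfl⟩)
    rw [hH, Polynomial.map_sub, Polynomial.map_mul, sub_eq_zero, Polynomial.map_map,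
      mapRingHom_comp] at hH0
    exact hH0
  have hint : ∀ i, IsIntegral A (Ideal.Quotient.mk J (MvPolynomial.X i)) := by
    have hF := isIntegral_coeff_coeff_of_dvd hP (hFm ▸ monic_monicOfCoeffs _)
      (Dvd.intro _ hFG)
    have hG := isIntegral_coeff_coeff_of_dvd hP (hGm ▸ monic_monicOfCoeffs _)
      (Dvd.intro_left _ hFG)
    rintro (⟨i, j⟩ | ⟨i, j⟩)
    · have := hF i j
      rwa [hFm, coeff_coeff_monicOfCoeffs] at this
    · have := hG i j
      rwa [hGm, coeff_coeff_monicOfCoeffs] at this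
  refine ⟨J, ⟨fun x => ?_⟩, ⟨_, _, by rw [← hFG, hFm, hGm]⟩, ?_⟩
  · obtain ⟨b, rfl⟩ := Ideal.Quotient.mk_surjective x
    induction b using MvPolynomial.induction_on with
    | C a => exact isIntegral_algebraMap (R := A) (A := B ⧸ J) (x := a)
    | add p q hp hq => rw [map_add]; exact hp.add hq
    | mul_X p i hp => rw [map_mul]; exact hp.mul (hint i)
  · intro k _ φ a b hab Δ hΔ
    -- A factorization over k is a point of the universal ring: `ev` extends φ and kills J.
    obtain ⟨ev, hev⟩ : ∃ ev : B →+* k, ev = MvPolynomial.eval₂Hom φ (Sum.elim a b) := ⟨_, rfl⟩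
    have hevA : ev.comp (algebraMap A B) = φ := by
      rw [hev]; exact RingHom.ext fun x => MvPolynomial.eval₂_C _ _ x
    have hevH : H.map (mapRingHom ev) = 0 := by
      rw [hH, Polynomial.map_sub, Polynomial.map_mul, Polynomial.map_map, mapRingHom_comp, hevA,
        ← hab, hFu, hGu, map_monicOfCoeffs, map_monicOfCoeffs, sub_eq_zero]
      congr 2 <;> funext ij <;> rw [hev]
      · exact MvPolynomial.eval₂_X φ (Sum.elim a b) (Sum.inl ij)
      · exact MvPolynomial.eval₂_X φ (Sum.elim a b) (Sum.inr ij)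
    have hJev : J ≤ RingHom.ker ev := by
      rw [hJ, Ideal.span_le]
      rintro _ ⟨i, j, rfl⟩
      have := congrArg (fun p => (p.coeff i).coeff j) hevH
      simpa using this
    have h1 : algebraMap A B Δ ∈ J := Ideal.Quotient.eq_zero_iff_mem.1 hΔ
    have h2 := hJev h1
    rwa [RingHom.mem_ker, ← RingHom.comp_apply, hevA] at h2

variable {σ k : Type*} [Field k] [IsAlgClosed k]

/-- The parameters admitting a factorization form a closed set: the universal factorization ring is
integral over the base, so by lying over its image is cut out by the kernel of the structure map.
Some Δ in that kernel does not vanish at s₀. -/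
theorem exists_eval_ne_zero_of_forall_mul_ne {P : (MvPolynomial σ k)[X][Y]} (hP : P.Monic)
    (s₀ : σ → k) (d e : ℕ)
    (h₀ : ∀ F G : k[X][Y], F.Monic → G.Monic → F.natDegree = d → G.natDegree = e →
      F * G ≠ P.map (mapRingHom (MvPolynomial.eval s₀))) :
    ∃ Δ : MvPolynomial σ k, MvPolynomial.eval s₀ Δ ≠ 0 ∧ ∀ s, MvPolynomial.eval s Δ ≠ 0 →
      ∀ F G : k[X][Y], F.Monic → G.Monic → F.natDegree = d → G.natDegree = e →
      F * G ≠ P.map (mapRingHom (MvPolynomial.eval s)) := by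
  classical
  obtain ⟨D, hD⟩ : ∃ D, ∀ i, (P.coeff i).natDegree ≤ D := by
    refine ⟨P.support.sup fun i => (P.coeff i).natDegree, fun i => ?_⟩
    by_cases hi : i ∈ P.support
    · exact Finset.le_sup (f := fun i => (P.coeff i).natDegree) hi
    · simp [notMem_support_iff.1 hi]
  obtain ⟨J, hint, ⟨a, b, hab⟩, hJ⟩ := exists_universal_factorization hP d e D
  have hker : ¬ RingHom.ker (algebraMap (MvPolynomial σ k) (_ ⧸ J)) ≤
      RingHom.ker (MvPolynomial.eval s₀) := by
    intro hle
    obtain ⟨ψ, hψ⟩ := exists_ringHom_of_isIntegral (MvPolynomial.eval s₀ : _ →+* k)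
      (fun a => ⟨MvPolynomial.C a, by simp⟩) hle
    refine h₀ (monicOfCoeffs d D (ψ ∘ a)) (monicOfCoeffs e D (ψ ∘ b)) (monic_monicOfCoeffs _)
      (monic_monicOfCoeffs _) (natDegree_monicOfCoeffs _) (natDegree_monicOfCoeffs _) ?_
    rw [← map_monicOfCoeffs, ← map_monicOfCoeffs, ← Polynomial.map_mul, hab, Polynomial.map_map,
      mapRingHom_comp, hψ]
  obtain ⟨Δ, hΔ, hΔ0⟩ := SetLike.not_le_iff_exists.1 hker
  refine ⟨Δ, hΔ0, fun s hs F G hF hG hFd hGe hmul => hs ?_⟩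
  have hP0 : P.map (mapRingHom (MvPolynomial.eval s)) ≠ 0 := (hP.map _).ne_zero
  have hDs : ∀ i, ((P.map (mapRingHom (MvPolynomial.eval s))).coeff i).natDegree ≤ D := by
    intro i
    rw [coeff_map, coe_mapRingHom]
    exact natDegree_map_le.trans (hD i)
  have hF' := eq_monicOfCoeffs hF hFd (natDegree_coeff_le_of_mul_eq hP0 hmul hDs)
  have hG' := eq_monicOfCoeffs hG hGe
    (natDegree_coeff_le_of_mul_eq hP0 (by rw [mul_comm, hmul]) hDs)
  exact hJ (MvPolynomial.eval s) _ _ (by rw [← hF', ← hG', hmul]) hΔ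

/-- Absolute irreducibility is an open condition in a family of monic polynomials. -/
theorem exists_eval_ne_zero_imp_irreducible {P : (MvPolynomial σ k)[X][Y]} (hP : P.Monic)
    (s₀ : σ → k) (h₀ : Irreducible (P.map (mapRingHom (MvPolynomial.eval s₀)))) :
    ∃ Δ : MvPolynomial σ k, MvPolynomial.eval s₀ Δ ≠ 0 ∧ ∀ s, MvPolynomial.eval s Δ ≠ 0 →
      Irreducible (P.map (mapRingHom (MvPolynomial.eval s))) := by
  classical
  have hdeg : ∀ s, (P.map (mapRingHom (MvPolynomial.eval s))).natDegree = P.natDegree :=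
    fun s => hP.natDegree_map _
  have hno : ∀ i ∈ Finset.Ioo 0 P.natDegree, ∀ F G : k[X][Y], F.Monic → G.Monic →
      F.natDegree = i → G.natDegree = P.natDegree - i →
      F * G ≠ P.map (mapRingHom (MvPolynomial.eval s₀)) := by
    intro i hi F G hF hG hFi hGi h
    rw [Finset.mem_Ioo] at hi
    have := ((hP.map (mapRingHom (MvPolynomial.eval s₀))).irreducible_iff_natDegree.1 h₀).2
      F G hF hG h
    omega
  choose! Δ hΔ₀ hΔ using fun i hi =>
    exists_eval_ne_zero_of_forall_mul_ne hP s₀ i (P.natDegree - i) (hno i hi)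
  -- One condition for each possible degree of a proper monic factor.
  refine ⟨∏ i ∈ Finset.Ioo 0 P.natDegree, Δ i, ?_, fun s hs => ?_⟩
  · rw [map_prod]
    exact Finset.prod_ne_zero_iff.2 hΔ₀
  · rw [map_prod, Finset.prod_ne_zero_iff] at hs
    rw [(hP.map _).irreducible_iff_natDegree]
    refine ⟨fun h1 => ?_, fun F G hF hG h => ?_⟩
    · have h2 := hdeg s
      rw [h1, natDegree_one, ← hdeg s₀] at h2
      exact h₀.ne_one ((hP.map _).natDegree_eq_zero.1 h2.symm)
    · have hsum : F.natDegree + G.natDegree = P.natDegree := by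
        rw [← hF.natDegree_mul hG, h, hdeg]
      by_contra! hne
      have hi : F.natDegree ∈ Finset.Ioo 0 P.natDegree := by
        rw [Finset.mem_Ioo]; omega
      exact hΔ _ hi s (hs _ hi) F G hF hG rfl (by omega) h

end Openness

/-! ### The pencil g - tX and its separability -/

theorem exists_injective_prod_X_sub_C {Ω : Type*} [Field Ω] [IsAlgClosed Ω] {f : Polynomial Ω}
    (hf : f.Monic) (hs : f.Separable) :
    ∃ r : Fin f.natDegree → Ω, Function.Injective r ∧ f = ∏ i, (X - C (r i)) := by
  have hsp := IsAlgClosed.splits f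
  have hnd := nodup_roots hs
  have hcard : f.roots.toList.length = f.natDegree := by
    rw [Multiset.length_toList, hsp.natDegree_eq_card_roots]
  refine ⟨fun i => f.roots.toList.get (i.cast hcard.symm), ?_, ?_⟩
  · have : f.roots.toList.Nodup := by rw [← Multiset.coe_nodup, Multiset.coe_toList]; exact hnd
    exact (List.nodup_iff_injective_get.1 this).comp (Fin.cast_injective _)
  · conv_lhs => rw [hsp.eq_prod_roots_of_monic hf, ← Multiset.coe_toList f.roots]
    rw [Multiset.map_coe, Multiset.prod_coe, ← Fin.prod_univ_fun_getElem]
    exact Fintype.prod_equiv (finCongr hcard) _ _ fun i => rfl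

theorem mem_range_algebraMap_of_aeval_eq_zero {k Ω : Type*} [Field k] [IsAlgClosed k] [Field Ω]
    [Algebra k Ω] {p : k[X]} (hp : p ≠ 0) {y : Ω} (hy : aeval y p = 0) :
    y ∈ Set.range (algebraMap k Ω) := by
  have hint : IsIntegral k y := isAlgebraic_iff_isIntegral.1 ⟨p, hp, hy⟩
  have h1 := IsAlgClosed.degree_eq_one_of_irreducible k (minpoly.irreducible hint)
  exact minpoly.mem_range_of_degree_eq_one k y h1

section pencil

variable {k Ω : Type*} [Field k] [Field Ω] [Algebra k Ω] {g : k[X]} {t : Ω}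

/-- A root y determines t = g(y)/y; the condition g(0) ≠ 0 excludes y = 0. -/
theorem mem_range_of_root_mem_range (h0 : g.eval 0 ≠ 0) {y : Ω} (hy : aeval y g = t * y)
    (hyk : y ∈ Set.range (algebraMap k Ω)) : t ∈ Set.range (algebraMap k Ω) := by
  obtain ⟨c, rfl⟩ := hyk
  rw [aeval_algebraMap_apply_eq_algebraMap_eval] at hy
  have hc : c ≠ 0 := by
    rintro rfl
    rw [map_zero, mul_zero, map_eq_zero] at hy
    exact h0 hy
  refine ⟨g.eval c / c, ?_⟩
  rw [map_div₀, hy, mul_div_assoc, div_self, mul_one]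
  rwa [Ne, map_eq_zero]

/-- A double root of g - tX is a root of g - X g', which is nonzero since its value at 0 is g(0). It
would lie in k, and then so would t. No assumption on the characteristic enters. -/
theorem aeval_derivative_ne_of_root [IsAlgClosed k] (h0 : g.eval 0 ≠ 0) (ht : t ∉ Set.range (algebraMap k Ω))
    {y : Ω} (hy : aeval y g = t * y) : aeval y (derivative g) ≠ t := by
  intro h
  refine ht (mem_range_of_root_mem_range h0 hy
    (mem_range_algebraMap_of_aeval_eq_zero (p := g - X * derivative g) ?_ ?_))
  · intro h1
    have := congrArg (eval 0) h1
    simp at this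
    exact h0 this
  · rw [map_sub, map_mul, aeval_X, h, hy]; ring

theorem separable_pencil [IsAlgClosed k] [IsAlgClosed Ω] (h0 : g.eval 0 ≠ 0)
    (ht : t ∉ Set.range (algebraMap k Ω)) :
    (g.map (algebraMap k Ω) - C t * X).Separable := by
  rw [separable_def, isCoprime_iff_aeval_ne_zero_of_isAlgClosed Ω Ω]
  intro y
  by_contra! h
  obtain ⟨h1, h2⟩ := h
  simp only [coe_aeval_eq_eval, eval_sub, eval_map_algebraMap, eval_mul, eval_C, eval_X,
    derivative_sub, derivative_map, derivative_mul, derivative_C, zero_mul, derivative_X, mul_one,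
    zero_add] at h1 h2
  exact aeval_derivative_ne_of_root h0 ht (sub_eq_zero.1 h1) (sub_eq_zero.1 h2)

theorem monic_pencil (hg : g.Monic) (hn : 2 ≤ g.natDegree) :
    (g.map (algebraMap k Ω) - C t * X).Monic := by
  refine (hg.map _).sub_of_left ?_
  rw [degree_map, degree_eq_natDegree hg.ne_zero]
  refine (degree_C_mul_X_le t).trans_lt ?_
  exact_mod_cast hn

theorem natDegree_pencil (hn : 2 ≤ g.natDegree) :
    (g.map (algebraMap k Ω) - C t * X).natDegree = g.natDegree := by
  rw [natDegree_sub_eq_left_of_natDegree_lt, natDegree_map]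
  rw [natDegree_map]
  exact (natDegree_C_mul_le t X).trans_lt (natDegree_X_le.trans_lt hn)

end pencil

/-! ### Double transitivity of the Galois group of the pencil -/

/-- The quotient of `Z g(X) - g(Z) X` by `X - Z` is, up to reversal, an Eisenstein polynomial. -/
theorem exists_irreducible_reverse {k : Type*} [Field k] {g : k[X]} (hg : g.Monic)
    (hn : 2 ≤ g.natDegree) (h0 : g.eval 0 ≠ 0) :
    ∃ Φ : k[X][Y], C X * g.map C - C g * X = (X - C X) * Φ ∧ Irreducible Φ.reverse ∧
      Φ.reverse.IsPrimitive := by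
  classical
  have hroot : (X - C X : k[X][Y]) ∣ C X * g.map C - C g * X := by
    rw [dvd_iff_isRoot, IsRoot]
    have : eval X (g.map C) = g := by rw [eval_map, ← coe_eval₂RingHom]; exact eval₂_C_X
    rw [eval_sub, eval_mul, eval_mul, eval_C, eval_C, eval_X, this, mul_comm, sub_self]
  obtain ⟨Φ, hΦ⟩ := hroot
  have hdegN : (C X * g.map C - C g * X : k[X][Y]).degree = g.natDegree ∧
      (C X * g.map C - C g * X : k[X][Y]).leadingCoeff = X := by
    have h1 : (C X * g.map C : k[X][Y]).degree = g.natDegree := by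
      rw [degree_C_mul X_ne_zero, degree_map_eq_of_injective C_injective,
        degree_eq_natDegree hg.ne_zero]
    have h2 : (C g * X : k[X][Y]).degree < (C X * g.map C : k[X][Y]).degree := by
      rw [h1]
      refine (degree_C_mul_X_le g).trans_lt ?_
      exact_mod_cast hn
    refine ⟨by rw [degree_sub_eq_left_of_degree_lt h2, h1], ?_⟩
    rw [leadingCoeff_sub_of_degree_lt h2, leadingCoeff_mul, leadingCoeff_C,
      (hg.map C).leadingCoeff, mul_one]
  have hlead : Φ.leadingCoeff = X := by
    rw [← hdegN.2, hΦ, leadingCoeff_mul, (monic_X_sub_C _).leadingCoeff, one_mul]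
  have hΦ0 : Φ ≠ 0 := by
    rintro rfl; simp at hlead; exact X_ne_zero hlead.symm
  have hdeg : Φ.natDegree + 1 = g.natDegree := by
    have h1 := natDegree_eq_of_degree_eq_some hdegN.1
    rw [hΦ, natDegree_mul (X_sub_C_ne_zero _) hΦ0, natDegree_X_sub_C] at h1
    omega
  -- Modulo Z the left side is -g(0) X, so Φ reduces to the constant -g(0). All higher coefficients
  -- are divisible by Z and the top one is exactly Z, which is the Eisenstein shape for the reverse.
  have hmod : Φ.map (evalRingHom 0) = C (-g.eval 0) := by
    have h1 := congrArg (Polynomial.map (evalRingHom (0 : k))) hΦ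
    simp only [Polynomial.map_sub, Polynomial.map_mul, map_C, map_X, coe_evalRingHom, eval_X,
      C_0, zero_mul, zero_sub, sub_zero] at h1
    apply mul_left_cancel₀ (X_ne_zero (R := k))
    rw [← h1, C_neg]; ring
  have hcoeff : ∀ i, (Φ.coeff i).eval 0 = (C (-g.eval 0) : k[X]).coeff i := by
    intro i; rw [← hmod, coeff_map, coe_evalRingHom]
  have hc0 : Φ.coeff 0 ∉ Ideal.span {(X : k[X])} := by
    rw [Ideal.mem_span_singleton, X_dvd_iff, coeff_zero_eq_eval_zero, hcoeff]
    simpa using h0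
  have hc0' : Φ.coeff 0 ≠ 0 := fun h => hc0 (h ▸ zero_mem _)
  have hrevdeg : Φ.reverse.natDegree = Φ.natDegree := by
    rw [reverse_natDegree, natTrailingDegree_eq_zero.2 (Or.inr hc0'), Nat.sub_zero]
  have hrevlead : Φ.reverse.leadingCoeff = Φ.coeff 0 := by
    rw [reverse_leadingCoeff, trailingCoeff, natTrailingDegree_eq_zero.2 (Or.inr hc0')]
  have hprim : Φ.reverse.IsPrimitive := by
    intro r hr
    rw [C_dvd_iff_dvd_coeff] at hr
    have h1 := hr 0
    rw [coeff_zero_reverse, hlead, irreducible_X.dvd_iff] at h1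
    refine h1.resolve_right fun h2 => hc0 ?_
    rw [Ideal.mem_span_singleton, ← hrevlead]
    exact h2.dvd.trans (hr _)
  refine ⟨Φ, hΦ, ?_, hprim⟩
  have hprime : (Ideal.span {(X : k[X])}).IsPrime :=
    (Ideal.span_singleton_prime X_ne_zero).2 prime_X
  refine irreducible_of_eisenstein_criterion hprime (by rwa [hrevlead]) ?_ ?_ ?_ hprim
  · intro i hi
    have hi' : i < Φ.natDegree := by
      rw [← hrevdeg]
      rw [degree_eq_natDegree (by simpa using hΦ0)] at hi
      exact_mod_cast hi
    rw [coeff_reverse, revAt_le hi'.le, Ideal.mem_span_singleton, X_dvd_iff,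
      coeff_zero_eq_eval_zero, hcoeff, coeff_C, if_neg (by omega)]
  · rw [← natDegree_pos_iff_degree_pos, hrevdeg]; omega
  · rw [coeff_zero_reverse, hlead, Ideal.span_singleton_pow, Ideal.mem_span_singleton]
    intro h
    have := (X_pow_dvd_iff.1 h) 1 (by norm_num)
    simp at this

/-- The stabilizer of a root of `g - t X` acts transitively on the other roots. -/
theorem exists_algEquiv_fixing_root {k Ω : Type*} [Field k] [IsAlgClosed k] [Field Ω]
    [IsAlgClosed Ω] [Algebra k Ω] [Algebra k[X] Ω] [IsScalarTower k k[X] Ω]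
    [FaithfulSMul k[X] Ω] [Algebra.IsAlgebraic k[X] Ω] {g : k[X]} (hg : g.Monic)
    (hn : 2 ≤ g.natDegree) (h0 : g.eval 0 ≠ 0) {x y z : Ω}
    (hx : aeval x g = algebraMap k[X] Ω X * x) (hy : aeval y g = algebraMap k[X] Ω X * y)
    (hz : aeval z g = algebraMap k[X] Ω X * z) (hyx : y ≠ x) (hzx : z ≠ x) :
    ∃ γ : Ω ≃ₐ[k[X]] Ω, γ x = x ∧ γ y = z := by
  have hinj : Function.Injective (algebraMap k[X] Ω) := FaithfulSMul.algebraMap_injective _ _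
  have ht : algebraMap k[X] Ω X ∉ Set.range (algebraMap k Ω) := by
    rintro ⟨c, hc⟩
    rw [IsScalarTower.algebraMap_apply k k[X] Ω] at hc
    have := congrArg natDegree (hinj hc)
    simp at this
  have hxk : x ∉ Set.range (algebraMap k Ω) := fun h => ht (mem_range_of_root_mem_range h0 hx h)
  have hne : ∀ w : Ω, aeval w g = algebraMap k[X] Ω X * w → w ≠ 0 := by
    rintro w hw rfl
    rw [mul_zero, ← map_zero (algebraMap k Ω), aeval_algebraMap_apply_eq_algebraMap_eval,
      map_zero, map_eq_zero] at hw
    exact h0 hw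
  -- Since x is transcendental over k, L is a copy of k(x); it contains t = g(x)/x, which gives ε.
  -- An automorphism over L therefore fixes both x and k[t].
  let e₀ : k[X] →+* Ω := (aeval x).toRingHom
  have he₀ : Function.Injective e₀ := by
    rw [injective_iff_map_eq_zero]
    intro p hp
    by_contra hp0
    exact hxk (mem_range_algebraMap_of_aeval_eq_zero hp0 hp)
  let L := RatFunc k
  let e : L →+* Ω := IsFractionRing.lift (K := L) he₀
  have he : ∀ p : k[X], e (algebraMap k[X] L p) = aeval x p := fun p =>
    IsFractionRing.lift_algebraMap he₀ p
  let := e.toAlgebra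
  let ε : k[X] →+* L := eval₂RingHom (algebraMap k L) (algebraMap k[X] L g / algebraMap k[X] L X)
  have hε : e.comp ε = algebraMap k[X] Ω := by
    apply Polynomial.ringHom_ext
    · intro c
      simp only [ε, RingHom.comp_apply, coe_eval₂RingHom, eval₂_C]
      rw [IsScalarTower.algebraMap_apply k k[X] L, he, ← C_eq_algebraMap, aeval_C, C_eq_algebraMap,
        ← IsScalarTower.algebraMap_apply k k[X] Ω]
    · simp only [ε, RingHom.comp_apply, coe_eval₂RingHom, eval₂_X]
      rw [map_div₀, he, he, aeval_X, hx, mul_div_assoc, div_self (hne x hx), mul_one]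
  have halg : Algebra.IsAlgebraic L Ω := by
    refine ⟨fun w => ?_⟩
    obtain ⟨p, hp, hpw⟩ := Algebra.IsAlgebraic.isAlgebraic (R := k[X]) w
    have hεinj : Function.Injective ε := by
      have : Function.Injective (e ∘ ε) := by
        rw [← RingHom.coe_comp, hε]; exact hinj
      exact this.of_comp
    refine ⟨p.map ε, (Polynomial.map_ne_zero_iff hεinj).2 hp, ?_⟩
    rw [aeval_def, eval₂_map]
    rw [aeval_def, ← hε] at hpw
    exact hpw
  obtain ⟨Φ, hΦ, hirr, hprim⟩ := exists_irreducible_reverse hg hn h0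
  -- At Z = x the polynomial Z g(w) - g(Z) w vanishes for every root w, so for w ≠ x the inverse of
  -- w is a root of the reversed quotient, which is irreducible over L.
  have hroot : ∀ w : Ω, aeval w g = algebraMap k[X] Ω X * w → w ≠ x →
      aeval w⁻¹ (Φ.reverse.map (algebraMap k[X] L)) = 0 := by
    intro w hw hwx
    have h1 := congrArg (eval₂ e₀ w) hΦ
    simp only [eval₂_sub, eval₂_mul, eval₂_C, eval₂_X] at h1
    have h2 : eval₂ e₀ w (g.map C) = aeval w g := by
      rw [eval₂_map, aeval_def]
      congr 1
      ext c; simp [e₀]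
    have h3 : e₀ X = x := aeval_X x
    have h4 : e₀ g = aeval x g := rfl
    rw [h2, h3, h4, hx, hw] at h1
    have h5 : eval₂ e₀ w Φ = 0 := by
      have h6 : (w - x) * eval₂ e₀ w Φ = 0 := by rw [← h1]; ring
      exact (mul_eq_zero.1 h6).resolve_left (sub_ne_zero.2 hwx)
    rw [aeval_def, eval₂_map]
    have h7 : (algebraMap L Ω).comp (algebraMap k[X] L) = e₀ := RingHom.ext he
    rw [h7]
    let := invertibleOfNonzero (hne w hw)
    rw [← invOf_eq_inv]
    exact (eval₂_reverse_eq_zero_iff e₀ w Φ).2 h5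
  have hirrL := (hprim.irreducible_iff_irreducible_map_fraction_map (K := L)).1 hirr
  have : IsAlgClosure L Ω := ⟨inferInstance, halg⟩
  have : Normal L Ω := IsAlgClosure.normal L Ω
  have hconj : IsConjRoot L z⁻¹ y⁻¹ := by
    rw [IsConjRoot, ← minpoly.eq_of_irreducible hirrL (hroot y hy hyx),
      ← minpoly.eq_of_irreducible hirrL (hroot z hz hzx)]
  obtain ⟨γ, hγ⟩ := isConjRoot_iff_exists_algEquiv.1 hconj
  refine ⟨AlgEquiv.ofRingEquiv (f := γ.toRingEquiv) fun p => ?_, ?_, ?_⟩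
  · have : algebraMap k[X] Ω p = algebraMap L Ω (ε p) := (RingHom.congr_fun hε p).symm
    rw [this]
    exact γ.commutes _
  · have h1 : x = algebraMap L Ω (algebraMap k[X] L X) := by
      rw [RingHom.algebraMap_toAlgebra, he, aeval_X]
    change γ x = x
    rw [h1, γ.commutes]
  · change γ y = z
    rw [map_inv₀] at hγ
    exact inv_injective hγ

/-! ### A transposition from the local analysis at t = 0 -/

theorem eval_pencil {k R : Type*} [CommRing k] [CommRing R] [Algebra k R] (g : k[X]) (t r : R) :
    (g.map (algebraMap k R) - C t * X).eval r = aeval r g - t * r := by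
  rw [eval_sub, eval_map_algebraMap, eval_mul, eval_C, eval_X]

theorem eval_derivative_pencil {k R : Type*} [CommRing k] [CommRing R] [Algebra k R] (g : k[X])
    (t r : R) :
    (derivative (g.map (algebraMap k R) - C t * X)).eval r = aeval r (derivative g) - t := by
  rw [derivative_sub, derivative_map, derivative_C_mul_X, eval_sub, eval_map_algebraMap, eval_C]

section hensel

variable {k : Type*} [Field k] {g m : k[X]}

theorem eval_derivative_ne_zero_of_root (hgm : g = (X - 1) ^ 2 * m) (hm : m.Separable)
    (hm1 : m.eval 1 ≠ 0) {c : k} (hc : m.eval c = 0) : (derivative g).eval c ≠ 0 := by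
  have h1 : (derivative m).eval c ≠ 0 := hm.eval₂_derivative_ne_zero (RingHom.id k) hc
  have h2 : c - 1 ≠ 0 := by
    intro h
    rw [sub_eq_zero.1 h] at hc
    exact hm1 hc
  rw [hgm]
  simp [hc, h1, h2]

theorem constantCoeff_aeval_powerSeries (p : k[X]) (r : PowerSeries k) :
    PowerSeries.constantCoeff (aeval r p) = p.eval (PowerSeries.constantCoeff r) := by
  rw [aeval_def, hom_eval₂, eval_eq_sum, eval₂_eq_sum]
  simp [PowerSeries.algebraMap_eq]

/-- Hensel's lemma: the roots of m are simple roots of g, the reduction of the pencil at t = 0. -/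
theorem exists_powerSeries_root (hg : g.Monic) (hn : 2 ≤ g.natDegree)
    (hgm : g = (X - 1) ^ 2 * m) (hm : m.Separable)
    (hm1 : m.eval 1 ≠ 0) {c : k} (hc : m.eval c = 0) :
    ∃ r : PowerSeries k, PowerSeries.constantCoeff r = c ∧ aeval r g = PowerSeries.X * r := by
  obtain ⟨f, hf⟩ : ∃ f : Polynomial (PowerSeries k),
    f = g.map (algebraMap k (PowerSeries k)) - C PowerSeries.X * X := ⟨_, rfl⟩
  have hfmon : f.Monic := by
    rw [hf]
    refine (hg.map _).sub_of_left ?_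
    rw [degree_map, degree_eq_natDegree hg.ne_zero]
    refine (degree_C_mul_X_le _).trans_lt ?_
    exact_mod_cast hn
  have hgc : g.eval c = 0 := by rw [hgm]; simp [hc]
  have hev : ∀ r, f.eval r = aeval r g - PowerSeries.X * r := by
    intro r; rw [hf, eval_pencil]
  obtain ⟨r, hr, hrc⟩ := (inferInstance : HenselianRing (PowerSeries k)
    (Ideal.span {PowerSeries.X})).is_henselian f hfmon (PowerSeries.C c) (by
      rw [hev, Ideal.mem_span_singleton, PowerSeries.X_dvd_iff, map_sub,
        constantCoeff_aeval_powerSeries]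
      simp [hgc]) (by
      refine IsUnit.map _ ?_
      rw [PowerSeries.isUnit_iff_constantCoeff]
      have : (derivative f).eval (PowerSeries.C c) =
          aeval (PowerSeries.C c) (derivative g) - PowerSeries.X := by
        rw [hf, eval_derivative_pencil]
      rw [this, map_sub, constantCoeff_aeval_powerSeries]
      simpa using eval_derivative_ne_zero_of_root hgm hm hm1 hc)
  refine ⟨r, ?_, ?_⟩
  · rw [Ideal.mem_span_singleton, PowerSeries.X_dvd_iff, map_sub, sub_eq_zero] at hrc
    simpa using hrc
  · rw [IsRoot, hev, sub_eq_zero] at hr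
    exact hr

theorem powerSeries_root_unique (hgm : g = (X - 1) ^ 2 * m) (hm : m.Separable)
    (hm1 : m.eval 1 ≠ 0) {r s : PowerSeries k}
    (hr : aeval r g = PowerSeries.X * r) (hs : aeval s g = PowerSeries.X * s)
    (hc : m.eval (PowerSeries.constantCoeff r) = 0)
    (hrs : PowerSeries.constantCoeff r = PowerSeries.constantCoeff s) : r = s := by
  obtain ⟨f, hf⟩ : ∃ f : Polynomial (PowerSeries k),
    f = g.map (algebraMap k (PowerSeries k)) - C PowerSeries.X * X := ⟨_, rfl⟩
  have hev : ∀ r, f.eval r = aeval r g - PowerSeries.X * r := by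
    intro r; rw [hf, eval_pencil]
  refine IsLocalRing.eq_of_eval_eq_zero_of_not_isUnit_sub (f := f) ?_ ?_ ?_ ?_
  · rw [hev, hr, sub_self]
  · rw [hev, hs, sub_self]
  · rw [PowerSeries.isUnit_iff_constantCoeff, map_sub, hrs, sub_self]
    exact not_isUnit_zero
  · rw [PowerSeries.isUnit_iff_constantCoeff]
    have : (derivative f).eval r = aeval r (derivative g) - PowerSeries.X := by
      rw [hf, eval_derivative_pencil]
    rw [this, map_sub, constantCoeff_aeval_powerSeries]
    simpa using eval_derivative_ne_zero_of_root hgm hm hm1 hc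

/-- No power series root reduces to the double root 1: with r = 1 + ts the equation becomes t s²
m(r) = r, whose constant terms are 0 and 1. -/
theorem eval_constantCoeff_eq_zero_of_powerSeries_root (hgm : g = (X - 1) ^ 2 * m)
    {r : PowerSeries k} (hr : aeval r g = PowerSeries.X * r) :
    m.eval (PowerSeries.constantCoeff r) = 0 := by
  have h1 := congrArg PowerSeries.constantCoeff hr
  rw [constantCoeff_aeval_powerSeries, map_mul, PowerSeries.constantCoeff_X, zero_mul, hgm] at h1
  simp only [eval_mul, eval_pow, eval_sub, eval_X, eval_one] at h1
  rcases mul_eq_zero.1 h1 with h2 | h2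
  · exfalso
    have h3 : PowerSeries.constantCoeff r = 1 := sub_eq_zero.1 (pow_eq_zero_iff two_ne_zero |>.1 h2)
    have h4 : PowerSeries.X ∣ r - 1 := by
      rw [PowerSeries.X_dvd_iff, map_sub, h3, map_one, sub_self]
    obtain ⟨s, hs⟩ := h4
    rw [hgm] at hr
    simp only [map_mul, map_pow, map_sub, aeval_X, map_one] at hr
    rw [hs, mul_pow, pow_two, mul_assoc, mul_assoc] at hr
    have h5 := mul_left_cancel₀ (PowerSeries.X_ne_zero) hr
    have h6 := congrArg PowerSeries.constantCoeff h5
    rw [h3] at h6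
    simp at h6
  · exact h2

end hensel

/-- Over `k((X))` the two roots of `g - X·Y` colliding at the double root of `g` are conjugate,
while all other roots are power series. -/
theorem exists_swap_of_powerSeries {k K₁ Ω : Type*} [Field k] [IsAlgClosed k] [Field K₁] [Field Ω]
    [Algebra (PowerSeries k) K₁] [IsFractionRing (PowerSeries k) K₁] [Algebra K₁ Ω]
    [Algebra (PowerSeries k) Ω] [IsScalarTower (PowerSeries k) K₁ Ω] [IsAlgClosed Ω]
    [Algebra.IsAlgebraic K₁ Ω] [Algebra k Ω] [IsScalarTower k (PowerSeries k) Ω] {g m : k[X]}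
    (hg : g.Monic) (hgm : g = (X - 1) ^ 2 * m) (hm : m.Separable)
    (hm1 : m.eval 1 ≠ 0) (hm0 : m.eval 0 ≠ 0) (r : Fin g.natDegree → Ω)
    (hr : Function.Injective r)
    (hroots : ∀ w, aeval w g = algebraMap (PowerSeries k) Ω PowerSeries.X * w ↔ ∃ i, r i = w) :
    ∃ a b, a ≠ b ∧ ∃ γ : Ω ≃ₐ[K₁] Ω, ∀ i, γ (r i) = r (Equiv.swap a b i) := by
  classical
  have hinj : Function.Injective (algebraMap (PowerSeries k) Ω) := by
    rw [IsScalarTower.algebraMap_eq (PowerSeries k) K₁ Ω, RingHom.coe_comp]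
    exact (algebraMap K₁ Ω).injective.comp (IsFractionRing.injective _ _)
  have hX1 : ((X - 1 : k[X]) ^ 2).Monic := by simpa using (monic_X_sub_C (1 : k)).pow 2
  have hmmon : m.Monic := hX1.of_mul_monic_left (hgm ▸ hg)
  have hdeg : g.natDegree = 2 + m.natDegree := by
    rw [hgm, hX1.natDegree_mul hmmon]
    congr 1
    rw [natDegree_pow, ← C_1, natDegree_X_sub_C]
  have hn : 2 ≤ g.natDegree := by omega
  have h0 : g.eval 0 ≠ 0 := by rw [hgm]; simpa using hm0
  have haev : ∀ s : PowerSeries k,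
      aeval (algebraMap (PowerSeries k) Ω s) g = algebraMap (PowerSeries k) Ω (aeval s g) :=
    fun s => aeval_algebraMap_apply Ω s g
  have haev' : ∀ s : PowerSeries k, aeval s g = PowerSeries.X * s ↔
      ∃ i, r i = algebraMap (PowerSeries k) Ω s := by
    intro s
    rw [← hroots, haev, ← map_mul, hinj.eq_iff]
  have hex : ∀ c ∈ m.roots.toFinset, ∃ i, ∃ s : PowerSeries k, PowerSeries.constantCoeff s = c ∧
      r i = algebraMap (PowerSeries k) Ω s := by
    intro c hc
    have hc' : m.eval c = 0 := by simpa [hmmon.ne_zero] using hc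
    obtain ⟨s, hs, hsg⟩ := exists_powerSeries_root hg hn hgm hm hm1 hc'
    obtain ⟨i, hi⟩ := (haev' s).1 hsg
    exact ⟨i, s, hs, hi⟩
  have : Nonempty (Fin g.natDegree) := ⟨⟨0, by omega⟩⟩
  choose! ι s hs hι using hex
  -- S indexes the roots that are power series, one for each root of m; exactly two roots remain.
  obtain ⟨S, hS⟩ : ∃ S : Finset (Fin g.natDegree), S = m.roots.toFinset.image ι := ⟨_, rfl⟩
  have hScard : S.card = m.natDegree := by
    rw [hS, Finset.card_image_of_injOn, Multiset.toFinset_card_of_nodup (nodup_roots hm),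
      (IsAlgClosed.splits m).natDegree_eq_card_roots]
    intro c hc d hd hcd
    rw [← hs c hc, ← hs d hd]
    congr 1
    apply hinj
    rw [← hι c hc, ← hι d hd, hcd]
  have hSc : ∀ i, (∃ q : PowerSeries k, r i = algebraMap (PowerSeries k) Ω q) → i ∈ S := by
    rintro i ⟨q, hq⟩
    have hqg := (haev' q).2 ⟨i, hq⟩
    have hc := eval_constantCoeff_eq_zero_of_powerSeries_root hgm hqg
    have hc' : PowerSeries.constantCoeff q ∈ m.roots.toFinset := by
      simpa [hmmon.ne_zero] using hc
    have : q = s (PowerSeries.constantCoeff q) :=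
      powerSeries_root_unique hgm hm hm1 hqg ((haev' _).2 ⟨_, hι _ hc'⟩) hc (hs _ hc').symm
    rw [hS]
    refine Finset.mem_image.2 ⟨_, hc', hr ?_⟩
    rw [hι _ hc', ← this, hq]
  have hcompl : Sᶜ.card = 2 := by
    rw [Finset.card_compl, Fintype.card_fin, hScard]; omega
  obtain ⟨a, b, hab, hSab⟩ := Finset.card_eq_two.1 hcompl
  have hmem : ∀ i, i ∉ S ↔ i = a ∨ i = b := by
    intro i
    rw [← Finset.mem_compl, hSab]; simp
  refine ⟨a, b, hab, ?_⟩
  obtain ⟨f, hf⟩ : ∃ f : Polynomial (PowerSeries k),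
    f = g.map (algebraMap k (PowerSeries k)) - C PowerSeries.X * X := ⟨_, rfl⟩
  have hfΩ : f.map (algebraMap (PowerSeries k) Ω) =
      g.map (algebraMap k Ω) - C (algebraMap (PowerSeries k) Ω PowerSeries.X) * X := by
    rw [hf, Polynomial.map_sub, Polynomial.map_map, ← IsScalarTower.algebraMap_eq]
    simp
  have htk : algebraMap (PowerSeries k) Ω PowerSeries.X ∉ Set.range (algebraMap k Ω) := by
    rintro ⟨c, hc⟩
    rw [IsScalarTower.algebraMap_apply k (PowerSeries k) Ω] at hc
    have := congrArg (PowerSeries.coeff 1) (hinj hc)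
    simp at this
  have hfmon : f.Monic := by
    refine monic_of_injective hinj ?_
    rw [hfΩ]
    exact monic_pencil hg hn
  have hsepΩ : (f.map (algebraMap (PowerSeries k) Ω)).Separable := by
    rw [hfΩ]; exact separable_pencil h0 htk
  have hfr : aeval (r a) (f.map (algebraMap (PowerSeries k) K₁)) = 0 := by
    rw [aeval_map_algebraMap, ← eval_map_algebraMap, hfΩ]
    have := (hroots (r a)).2 ⟨a, rfl⟩
    simp [eval_map_algebraMap, this]
  have hsep : IsSeparable K₁ (r a) := by
    have h1 : (f.map (algebraMap (PowerSeries k) K₁)).Separable := by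
      rw [← separable_map (algebraMap K₁ Ω), Polynomial.map_map, ← IsScalarTower.algebraMap_eq]
      exact hsepΩ
    exact h1.of_dvd (minpoly.dvd _ _ hfr)
  -- Power series are integrally closed, so a root in their fraction field would be a power series
  -- and have its index in S.
  have hnot : r a ∉ (⊥ : Subalgebra K₁ Ω) := by
    rintro ⟨q, hq⟩
    have hq' : algebraMap K₁ Ω q = r a := hq
    have hint : IsIntegral (PowerSeries k) q := by
      refine ⟨f, hfmon, ?_⟩
      rw [aeval_map_algebraMap, ← hq', aeval_algebraMap_apply, map_eq_zero] at hfr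
      exact hfr
    obtain ⟨p, hp⟩ := IsIntegrallyClosed.isIntegral_iff.1 hint
    refine (hmem a).2 (Or.inl rfl) (hSc a ⟨p, ?_⟩)
    rw [← hq', ← hp, ← IsScalarTower.algebraMap_apply]
  obtain ⟨y, hy, hconj⟩ := (notMem_iff_exists_ne_and_isConjRoot hsep (IsAlgClosed.splits _)).1 hnot
  have : IsAlgClosure K₁ Ω := ⟨inferInstance, inferInstance⟩
  have : Normal K₁ Ω := IsAlgClosure.normal K₁ Ω
  obtain ⟨γ, hγ⟩ := isConjRoot_iff_exists_algEquiv.1 hconj.symm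
  have hγR : ∀ q, γ (algebraMap (PowerSeries k) Ω q) = algebraMap (PowerSeries k) Ω q := by
    intro q
    rw [IsScalarTower.algebraMap_apply _ K₁ Ω, γ.commutes]
  have hperm : ∀ i, ∃ j, r j = γ (r i) := by
    intro i
    rw [← hroots]
    have h1 := congrArg γ ((hroots (r i)).2 ⟨i, rfl⟩)
    rw [map_mul, hγR] at h1
    rw [← h1, aeval_def, aeval_def]
    have h2 : (γ : Ω →+* Ω).comp (algebraMap k Ω) = algebraMap k Ω := by
      ext c
      rw [RingHom.comp_apply, IsScalarTower.algebraMap_apply k (PowerSeries k) Ω]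
      exact hγR _
    have h3 := hom_eval₂ g (algebraMap k Ω) (γ : Ω →+* Ω) (r i)
    rw [h2] at h3
    exact h3.symm
  choose π hπ using hperm
  have hπinj : Function.Injective π := fun i j hij => by
    have := hπ i
    rw [hij, hπ j] at this
    exact (hr (γ.injective this)).symm
  -- The automorphism fixes the power series roots and moves `r a`, so it must exchange the
  -- remaining two.
  have hπS : ∀ i ∈ S, π i = i := by
    intro i hi
    rw [hS] at hi
    obtain ⟨c, hc, rfl⟩ := Finset.mem_image.1 hi
    apply hr
    rw [hπ, hι c hc, hγR]
  have hπa : π a ≠ a := by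
    intro h
    have := hπ a
    rw [h, hγ] at this
    exact hy this
  have hπnot : ∀ i, i ∉ S → π i ∉ S := fun i hi h => hi (hπinj (hπS _ h) ▸ h)
  have ha : π a = b := ((hmem _).1 (hπnot a ((hmem a).2 (Or.inl rfl)))).resolve_left hπa
  have hb : π b = a := by
    refine ((hmem _).1 (hπnot b ((hmem b).2 (Or.inr rfl)))).resolve_right fun h => hab ?_
    exact hπinj (ha.trans h.symm)
  refine ⟨γ, fun i => ?_⟩
  rw [← hπ i]
  congr 1
  by_cases hi : i ∈ S
  · rw [hπS i hi, Equiv.swap_apply_of_ne_of_ne]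
    · rintro rfl; exact (hmem i).2 (Or.inl rfl) hi
    · rintro rfl; exact (hmem i).2 (Or.inr rfl) hi
  · rcases (hmem i).1 hi with rfl | rfl
    · rw [ha, Equiv.swap_apply_left]
    · rw [hb, Equiv.swap_apply_right]

-- The closure of k(t) embeds into a closure of k((t)); being normal over k(t), it is stable under
-- the local automorphism, which restricts to it.
set_option synthInstance.maxHeartbeats 200000 in
theorem exists_algEquiv_swap_roots {k Ω : Type*} [Field k] [IsAlgClosed k] [Field Ω]
    [IsAlgClosed Ω] [Algebra k Ω] [Algebra k[X] Ω] [IsScalarTower k k[X] Ω]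
    [FaithfulSMul k[X] Ω] [Algebra.IsAlgebraic k[X] Ω] {g m : k[X]}
    (hg : g.Monic) (hgm : g = (X - 1) ^ 2 * m) (hm : m.Separable)
    (hm1 : m.eval 1 ≠ 0) (hm0 : m.eval 0 ≠ 0) (r : Fin g.natDegree → Ω)
    (hr : Function.Injective r)
    (hroots : g.map (algebraMap k Ω) - C (algebraMap k[X] Ω X) * X = ∏ i, (X - C (r i))) :
    ∃ a b, a ≠ b ∧ ∃ γ : Ω ≃ₐ[k[X]] Ω, ∀ i, γ (r i) = r (Equiv.swap a b i) := by
  let F := FractionRing k[X]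
  let K₁ := FractionRing (PowerSeries k)
  let Ω₁ := AlgebraicClosure K₁
  have hXP : Function.Injective (algebraMap k[X] (PowerSeries k)) := Polynomial.coe_injective k
  have : FaithfulSMul k[X] K₁ := by
    rw [faithfulSMul_iff_algebraMap_injective, IsScalarTower.algebraMap_eq k[X] (PowerSeries k) K₁,
      RingHom.coe_comp]
    exact (IsFractionRing.injective _ _).comp hXP
  let : Algebra F Ω := FractionRing.liftAlgebra k[X] Ω
  have : IsScalarTower k[X] F Ω := FractionRing.isScalarTower_liftAlgebra k[X] Ω
  let : Algebra F K₁ := FractionRing.liftAlgebra k[X] K₁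
  have : IsScalarTower k[X] F K₁ := FractionRing.isScalarTower_liftAlgebra k[X] K₁
  have : Algebra.IsAlgebraic F Ω :=
    Algebra.IsAlgebraic.extendScalars (R := k[X]) (IsFractionRing.injective k[X] F)
  let j : Ω →ₐ[F] Ω₁ := IsAlgClosed.lift
  let := j.toRingHom.toAlgebra
  have : IsScalarTower F Ω Ω₁ := IsScalarTower.of_algebraMap_eq fun x => (j.commutes x).symm
  have hjX : ∀ p : k[X], j (algebraMap k[X] Ω p) =
      algebraMap (PowerSeries k) Ω₁ (algebraMap k[X] (PowerSeries k) p) := by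
    intro p
    rw [IsScalarTower.algebraMap_apply k[X] F Ω, j.commutes,
      IsScalarTower.algebraMap_apply F K₁ Ω₁, ← IsScalarTower.algebraMap_apply k[X] F K₁,
      IsScalarTower.algebraMap_apply k[X] (PowerSeries k) K₁,
      ← IsScalarTower.algebraMap_apply (PowerSeries k) K₁ Ω₁]
  have hjk : j.toRingHom.comp (algebraMap k Ω) = algebraMap k Ω₁ := by
    ext c
    have := hjX (C c)
    rw [IsScalarTower.algebraMap_apply k (PowerSeries k) Ω₁, RingHom.comp_apply,
      IsScalarTower.algebraMap_apply k k[X] Ω]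
    refine this.trans ?_
    congr 1
    exact Polynomial.coe_C c
  have hpoly : g.map (algebraMap k Ω₁) - C (algebraMap (PowerSeries k) Ω₁ PowerSeries.X) * X =
      ∏ i, (X - C (j (r i))) := by
    have h1 := congrArg (Polynomial.map j.toRingHom) hroots
    rw [Polynomial.map_sub, Polynomial.map_map, hjk, Polynomial.map_mul, map_C, map_X,
      Polynomial.map_prod] at h1
    have h2 : j.toRingHom (algebraMap k[X] Ω X) = algebraMap (PowerSeries k) Ω₁ PowerSeries.X := by
      have := hjX X
      refine this.trans ?_
      congr 1
      exact Polynomial.coe_X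
    rw [h2] at h1
    rw [h1]
    refine Finset.prod_congr rfl fun i _ => ?_
    simp
  obtain ⟨a, b, hab, γ, hγ⟩ := exists_swap_of_powerSeries (K₁ := K₁) (Ω := Ω₁) hg hgm hm hm1 hm0
    (fun i => j (r i)) (j.toRingHom.injective.comp hr) (fun w => by
      rw [← sub_eq_zero, ← eval_pencil, hpoly, eval_prod, Finset.prod_eq_zero_iff]
      simp only [Finset.mem_univ, true_and, eval_sub, eval_X, eval_C, sub_eq_zero]
      simp only [eq_comm])
  refine ⟨a, b, hab, ?_⟩
  have : IsAlgClosure F Ω := ⟨inferInstance, inferInstance⟩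
  have : Normal F Ω := IsAlgClosure.normal F Ω
  let γF : Ω₁ ≃ₐ[F] Ω₁ := AlgEquiv.ofRingEquiv (f := γ.toRingEquiv) fun x => by
    rw [IsScalarTower.algebraMap_apply F K₁ Ω₁]
    exact γ.commutes _
  let γ' := γF.restrictNormal Ω
  refine ⟨γ'.restrictScalars k[X], fun i => ?_⟩
  apply j.toRingHom.injective
  have := γF.restrictNormal_commutes Ω (r i)
  exact this.trans (hγ i)

/-- Every permutation of the roots of `g - X·Y` over `k(X)` is induced by an automorphism. -/
theorem exists_algEquiv_perm_roots {k Ω : Type*} [Field k] [IsAlgClosed k] [Field Ω]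
    [IsAlgClosed Ω] [Algebra k Ω] [Algebra k[X] Ω] [IsScalarTower k k[X] Ω]
    [FaithfulSMul k[X] Ω] [Algebra.IsAlgebraic k[X] Ω] {g m : k[X]}
    (hg : g.Monic) (hn : 2 ≤ g.natDegree) (hgm : g = (X - 1) ^ 2 * m) (hm : m.Separable)
    (hm1 : m.eval 1 ≠ 0) (hm0 : m.eval 0 ≠ 0) (r : Fin g.natDegree → Ω)
    (hr : Function.Injective r)
    (hroots : g.map (algebraMap k Ω) - C (algebraMap k[X] Ω X) * X = ∏ i, (X - C (r i)))
    (π : Equiv.Perm (Fin g.natDegree)) :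
    ∃ γ : Ω ≃ₐ[k[X]] Ω, ∀ i, γ (r i) = r (π i) := by
  classical
  let H : Subgroup (Equiv.Perm (Fin g.natDegree)) :=
    { carrier := {π | ∃ γ : Ω ≃ₐ[k[X]] Ω, ∀ i, γ (r i) = r (π i)}
      one_mem' := ⟨1, fun i => rfl⟩
      mul_mem' := by
        rintro π₁ π₂ ⟨γ₁, h₁⟩ ⟨γ₂, h₂⟩
        exact ⟨γ₁ * γ₂, fun i => by rw [AlgEquiv.mul_apply, h₂, h₁]; rfl⟩
      inv_mem' := by
        rintro π ⟨γ, h⟩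
        refine ⟨γ⁻¹, fun i => γ.injective ?_⟩
        rw [h]
        simp }
  have hroot : ∀ i, aeval (r i) g = algebraMap k[X] Ω X * r i := by
    intro i
    rw [← sub_eq_zero, ← eval_pencil, hroots, eval_prod]
    exact Finset.prod_eq_zero (Finset.mem_univ i) (by simp)
  have hperm : ∀ γ : Ω ≃ₐ[k[X]] Ω, ∃ π : Equiv.Perm (Fin g.natDegree), ∀ i, γ (r i) = r (π i) := by
    intro γ
    have h1 : ∀ i, ∃ j, r j = γ (r i) := by
      intro i
      have h2 := congrArg γ (hroot i)
      rw [map_mul, γ.commutes, ← AlgEquiv.coe_toAlgHom, ← AlgHom.coe_restrictScalars' k,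
        ← aeval_algHom_apply, ← sub_eq_zero, ← eval_pencil, hroots, eval_prod,
        Finset.prod_eq_zero_iff] at h2
      obtain ⟨j, -, hj⟩ := h2
      rw [eval_sub, eval_X, eval_C, sub_eq_zero] at hj
      exact ⟨j, hj.symm⟩
    choose π hπ using h1
    have hπinj : Function.Injective π := fun i j hij => by
      have := hπ i
      rw [hij, hπ j] at this
      exact (hr (γ.injective this)).symm
    exact ⟨Equiv.ofBijective π (Finite.injective_iff_bijective.1 hπinj), fun i => (hπ i).symm⟩
  obtain ⟨a, b, hab, hswap⟩ := exists_algEquiv_swap_roots hg hgm hm hm1 hm0 r hr hroots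
  have h0 : g.eval 0 ≠ 0 := by rw [hgm]; simpa using hm0
  -- The transposition comes from t = 0, the transitivity of the stabilizer from the Eisenstein
  -- argument.
  have hH : H = ⊤ := by
    refine subgroup_eq_top_of_swap_mem H (a := a) (b := b) hswap fun y hy => ?_
    obtain ⟨γ, hγa, hγb⟩ := exists_algEquiv_fixing_root hg hn h0 (hroot a) (hroot b) (hroot y)
      (hr.ne hab.symm) (hr.ne hy)
    obtain ⟨π, hπ⟩ := hperm γ
    refine ⟨π, ⟨γ, hπ⟩, hr ?_, hr ?_⟩
    · rw [← hπ, hγa]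
    · rw [← hπ, hγb]
  have : π ∈ H := hH ▸ Subgroup.mem_top π
  exact this

/-! ### Resolvents, their descent to M and their specialization -/

/-- The polynomial `∏_σ (U - ∑ d_i x_{σ i})` with indeterminates `x_i`. -/
noncomputable def genericResolvent {ι R : Type*} [Fintype ι] [DecidableEq ι] [CommRing R]
    (d : ι → R) : Polynomial (MvPolynomial ι R) :=
  ∏ σ : Equiv.Perm ι, (X - C (∑ i, MvPolynomial.C (d i) * MvPolynomial.X (σ i)))

section genericResolvent

variable {ι R S : Type*} [Fintype ι] [DecidableEq ι] [CommRing R] [CommRing S] (d : ι → R)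

theorem monic_genericResolvent : (genericResolvent d).Monic :=
  monic_prod_of_monic _ _ fun _ _ => monic_X_sub_C _

theorem map_genericResolvent (f : R →+* S) :
    (genericResolvent d).map (MvPolynomial.map f) = genericResolvent (f ∘ d) := by
  simp only [genericResolvent, Polynomial.map_prod, Polynomial.map_sub, map_X, map_C]
  simp

/-- The substitution σ ↦ eσ reindexes the product; hence the coefficients are symmetric polynomials.
-/
theorem rename_genericResolvent (e : Equiv.Perm ι) :
    (genericResolvent d).map (MvPolynomial.rename (R := R) e).toRingHom = genericResolvent d := by
  simp only [genericResolvent, Polynomial.map_prod, Polynomial.map_sub, map_X, map_C]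
  refine Fintype.prod_equiv (Equiv.mulLeft e) _ _ fun σ => ?_
  simp

/-- The substitution σ ↦ σe⁻¹ reindexes the product; this yields Galois invariance when d lists
conjugates. -/
theorem genericResolvent_comp (e : Equiv.Perm ι) :
    genericResolvent (d ∘ e) = genericResolvent d := by
  simp only [genericResolvent]
  refine Fintype.prod_equiv (Equiv.mulRight e⁻¹) _ _ fun σ => ?_
  congr 2
  refine Fintype.sum_equiv e _ _ fun i => ?_
  simp

theorem eval₂_genericResolvent (f : R →+* S) (x : ι → S) :
    (genericResolvent d).map (MvPolynomial.eval₂Hom f x) =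
      ∏ σ : Equiv.Perm ι, (X - C (∑ i, f (d i) * x (σ i))) := by
  simp only [genericResolvent, Polynomial.map_prod, Polynomial.map_sub, map_X, map_C]
  simp

end genericResolvent

/-- Injectivity of f carries the symmetry down to R, where the fundamental theorem of symmetric
polynomials applies. -/
theorem mem_range_eval₂Hom_esymm {ι R S : Type*} [Fintype ι] [CommRing R] [CommRing S]
    {f : R →+* S} (hf : Function.Injective f) {n : ℕ} (hn : Fintype.card ι = n)
    {p : MvPolynomial ι S} (hp : p.IsSymmetric) (hc : ∀ s, p.coeff s ∈ Set.range f) :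
    p ∈ Set.range (MvPolynomial.eval₂Hom (MvPolynomial.C.comp f)
      (fun i : Fin n => MvPolynomial.esymm ι S (i + 1))) := by
  obtain ⟨q, rfl⟩ : p ∈ Set.range (MvPolynomial.map (σ := ι) f) := by
    rw [MvPolynomial.mem_range_map_iff_coeffs_subset]
    intro c hcs
    obtain ⟨s, -, rfl⟩ := MvPolynomial.mem_coeffs_iff.1 hcs
    exact hc s
  have hq : q ∈ MvPolynomial.symmetricSubalgebra ι R := by
    intro e
    apply MvPolynomial.map_injective f hf
    rw [MvPolynomial.map_rename]
    exact hp e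
  obtain ⟨r, hr⟩ := MvPolynomial.esymmAlgHom_surjective (σ := ι) R hn.le ⟨q, hq⟩
  refine ⟨r, ?_⟩
  have h1 := congrArg Subtype.val hr
  rw [MvPolynomial.esymmAlgHom_apply] at h1
  change _ = q at h1
  rw [← h1]
  change _ = (MvPolynomial.map f) (MvPolynomial.aeval _ r)
  rw [MvPolynomial.aeval_def, MvPolynomial.coe_eval₂Hom, MvPolynomial.hom_eval₂]
  congr 1
  · ext; simp [MvPolynomial.algebraMap_eq]
  · funext i
    simp [MvPolynomial.map_esymm]

section resolvent

variable {M N E : Type*} [Field M] [Field N] [Algebra M N] [Field E] [Algebra M E]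
  [IsAlgClosed E] [Algebra.IsAlgebraic M E] [Algebra.IsSeparable M N] [Fintype (N →ₐ[M] E)]

theorem mem_range_algebraMap_of_fixed {c : E} (hs : IsSeparable M c)
    (h : ∀ γ : E ≃ₐ[M] E, γ c = c) : c ∈ Set.range (algebraMap M E) := by
  have : IsAlgClosure M E := ⟨inferInstance, inferInstance⟩
  have : Normal M E := IsAlgClosure.normal M E
  by_contra hc
  have hc' : c ∉ (⊥ : Subalgebra M E) := fun h => hc (Algebra.mem_bot.1 h)
  obtain ⟨y, hy, hconj⟩ := (notMem_iff_exists_ne_and_isConjRoot hs (IsAlgClosed.splits _)).1 hc'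
  obtain ⟨γ, hγ⟩ := isConjRoot_iff_exists_algEquiv.1 hconj
  exact hy (γ.injective (by rw [h, hγ]))

/-- The coefficients are polynomial expressions in the φ(δ), hence separable over M, and
automorphisms of E only permute the embeddings φ. -/
theorem coeff_genericResolvent_mem_range [DecidableEq (N →ₐ[M] E)] (δ : N) (i : ℕ)
    (s : (N →ₐ[M] E) →₀ ℕ) :
    ((genericResolvent fun φ : N →ₐ[M] E => φ δ).coeff i).coeff s ∈
      Set.range (algebraMap M E) := by
  refine mem_range_algebraMap_of_fixed ?_ fun γ => ?_
  · rw [← mem_separableClosure_iff]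
    have h1 : ∀ φ : N →ₐ[M] E, φ δ ∈ separableClosure M E := by
      intro φ
      rw [mem_separableClosure_iff, IsSeparable, minpoly.algHom_eq φ φ.injective]
      exact Algebra.IsSeparable.isSeparable M δ
    have h2 := map_genericResolvent (fun φ : N →ₐ[M] E => (⟨φ δ, h1 φ⟩ : separableClosure M E))
      (algebraMap (separableClosure M E) E)
    have h3 : (algebraMap (separableClosure M E) E) ∘
      (fun φ : N →ₐ[M] E => (⟨φ δ, h1 φ⟩ : separableClosure M E)) = fun φ => φ δ := rfl
    rw [← h3, ← h2, coeff_map, MvPolynomial.coeff_map]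
    exact Subtype.property _
  · let ρ : Equiv.Perm (N →ₐ[M] E) := (AlgEquiv.refl (R := M) (A₁ := N)).arrowCongr γ
    have h1 : (γ : E →+* E) ∘ (fun φ : N →ₐ[M] E => φ δ) = (fun φ : N →ₐ[M] E => φ δ) ∘ ρ := by
      funext φ; simp [ρ]
    have h2 := map_genericResolvent (fun φ : N →ₐ[M] E => φ δ) (γ : E →+* E)
    rw [h1, genericResolvent_comp] at h2
    conv_rhs => rw [← h2, coeff_map, MvPolynomial.coeff_map]
    rfl

/-- The resolvent descends to `M`. -/
theorem exists_descended_resolvent [DecidableEq (N →ₐ[M] E)] {n : ℕ}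
    (hn : Fintype.card (N →ₐ[M] E) = n) (δ : N) :
    ∃ Q : Polynomial (MvPolynomial (Fin n) M), Q.Monic ∧
      Q.map (MvPolynomial.eval₂Hom (MvPolynomial.C.comp (algebraMap M E))
        (fun i : Fin n => MvPolynomial.esymm (N →ₐ[M] E) E (i + 1))) =
      genericResolvent fun φ : N →ₐ[M] E => φ δ := by
  have hl : genericResolvent (fun φ : N →ₐ[M] E => φ δ) ∈
      lifts (MvPolynomial.eval₂Hom (MvPolynomial.C.comp (algebraMap M E))
        (fun i : Fin n => MvPolynomial.esymm (N →ₐ[M] E) E (i + 1))) := by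
    rw [lifts_iff_coeff_lifts]
    intro i
    refine mem_range_eval₂Hom_esymm (algebraMap M E).injective hn (fun e => ?_)
      (coeff_genericResolvent_mem_range δ i)
    conv_rhs => rw [← rename_genericResolvent _ e, coeff_map]
    rfl
  obtain ⟨Q, h1, -, h2⟩ := lifts_and_natDegree_eq_and_monic hl (monic_genericResolvent _)
  exact ⟨Q, h2, h1⟩

end resolvent

/-- Specialization of a polynomial with coefficients in the elementary symmetric polynomials at the
roots of `f`. -/
noncomputable def specialize {M B : Type*} [CommRing M] [CommRing B] {n : ℕ}
    (Q : Polynomial (MvPolynomial (Fin n) M)) (ψ : M →+* B) (f : B[X]) : B[X] :=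
  -- Vieta's formula for e_{i+1} of the roots of a monic f of degree n; the index i starts at 0.
  Q.map (MvPolynomial.eval₂Hom ψ fun i : Fin n => (-1) ^ (i + 1 : ℕ) * f.coeff (n - (i + 1)))

section specialize

variable {M B B' : Type*} [CommRing M] [CommRing B] [CommRing B'] {n : ℕ}
  {Q : Polynomial (MvPolynomial (Fin n) M)}

theorem monic_specialize (hQ : Q.Monic) (ψ : M →+* B) (f : B[X]) : (specialize Q ψ f).Monic :=
  hQ.map _

theorem map_specialize (ψ : M →+* B) (f : B[X]) (h : B →+* B') :
    (specialize Q ψ f).map h = specialize Q (h.comp ψ) (f.map h) := by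
  rw [specialize, specialize, Polynomial.map_map]
  congr 1
  apply MvPolynomial.ringHom_ext
  · simp
  · simp

theorem specialize_eq_prod {ι E L : Type*} [Fintype ι] [DecidableEq ι] [CommRing E] [CommRing L]
    (hn : Fintype.card ι = n) {d : ι → E} {a : M →+* E}
    (hQ : Q.map (MvPolynomial.eval₂Hom (MvPolynomial.C.comp a)
        (fun i : Fin n => MvPolynomial.esymm ι E (i + 1))) = genericResolvent d)
    (θ : E →+* L) {f : L[X]} (x : ι → L) (hf : f = ∏ i, (X - C (x i))) :
    specialize Q (θ.comp a) f = ∏ σ : Equiv.Perm ι, (X - C (∑ i, θ (d i) * x (σ i))) := by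
  rw [← eval₂_genericResolvent, ← hQ, Polynomial.map_map, specialize]
  congr 1
  apply MvPolynomial.ringHom_ext
  · simp
  · intro i
    have h1 : f = (Multiset.map (fun t => X - C t) (Multiset.map x Finset.univ.val)).prod := by
      rw [hf, Multiset.map_map]; rfl
    have h2 : (Multiset.map x Finset.univ.val).card = n := by simp [hn]
    rw [MvPolynomial.eval₂Hom_X', h1, Multiset.prod_X_sub_C_coeff _ (by omega), h2]
    have h3 : n - (n - ((i : ℕ) + 1)) = i + 1 := by omega
    rw [h3, ← mul_assoc, ← mul_pow]
    simp only [mul_neg, mul_one, neg_neg, one_pow, one_mul, RingHom.comp_apply,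
      MvPolynomial.eval₂Hom_X', MvPolynomial.coe_eval₂Hom]
    let := θ.toAlgebra
    exact (MvPolynomial.aeval_esymm_eq_multiset_esymm ι E (i + 1) x).symm

end specialize

/-! ### From self-adjoint operators to scaled trace forms -/

theorem isSeparable_adjoinRoot {K : Type*} [Field K] {f : K[X]} [Fact (Irreducible f)]
    (hs : f.Separable) : Algebra.IsSeparable K (AdjoinRoot f) := by
  have hf : Irreducible f := Fact.out
  have h1 : IsSeparable K (AdjoinRoot.root f) := by
    refine hs.of_dvd (minpoly.dvd K _ ?_)
    rw [aeval_def]; exact AdjoinRoot.eval₂_root f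
  have h2 : IntermediateField.adjoin K {AdjoinRoot.root f} = ⊤ := by
    rw [eq_top_iff]
    intro x _
    have h3 : x ∈ Algebra.adjoin K {AdjoinRoot.root f} := by
      rw [AdjoinRoot.adjoinRoot_eq_top]; trivial
    exact IntermediateField.algebra_adjoin_le_adjoin K _ h3
  have h4 := (IntermediateField.isSeparable_adjoin_simple_iff_isSeparable K (AdjoinRoot f)).2 h1
  rw [h2] at h4
  exact AlgEquiv.Algebra.isSeparable (IntermediateField.topEquiv (F := K) (E := AdjoinRoot f))

/-- A quadratic space on which a separable field extension of the right degree acts by self-adjoint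
operators is a scaled trace form. -/
theorem isIsomorphicToScaledTraceForm_of_field {K : Type u} {V : Type*} [Field K]
    (h2 : (2 : K) ≠ 0) [AddCommGroup V] [Module K V] [FiniteDimensional K V]
    (Q : QuadraticForm K V) (hQ : Q ≠ 0) {F : Type u} [Field F] [Algebra K F]
    [FiniteDimensional K F] [Algebra.IsSeparable K F] (ρ : F →ₐ[K] Module.End K V)
    (hadj : ∀ x u w, QuadraticMap.polar Q (ρ x u) w = QuadraticMap.polar Q u (ρ x w))
    (hdim : Module.finrank K F = Module.finrank K V) :
    IsIsomorphicToScaledTraceForm Q := by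
  have : Nontrivial V := by
    obtain ⟨v, hv⟩ := DFunLike.ne_iff.1 hQ
    exact ⟨v, 0, fun h => hv (by rw [h]; simp)⟩
  obtain ⟨v, hv⟩ := exists_ne (0 : V)
  -- The orbit map of a nonzero v is injective because F is a field, hence bijective by dimension.
  obtain ⟨L, hL⟩ : ∃ L : F →ₗ[K] V, ∀ x, L x = ρ x v :=
    ⟨(LinearMap.applyₗ v).comp ρ.toLinearMap, fun x => rfl⟩
  have hLinj : Function.Injective L := by
    rw [← LinearMap.ker_eq_bot, LinearMap.ker_eq_bot']
    intro x hx
    by_contra hx0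
    apply hv
    have h1 : ρ (x⁻¹ * x) v = 0 := by
      rw [map_mul, Module.End.mul_apply, ← hL, hx, map_zero]
    rwa [inv_mul_cancel₀ hx0, map_one, Module.End.one_apply] at h1
  obtain ⟨e, he⟩ : ∃ e : F ≃ₗ[K] V, ∀ x, e x = ρ x v :=
    ⟨LinearEquiv.ofInjectiveOfFinrankEq L hLinj hdim, hL⟩
  -- By self-adjointness, Q(xv) is half of polar(xv, xv) = polar(v, x²v), that is ℓ(x²).
  obtain ⟨ℓ, hℓ'⟩ : ∃ ℓ : Module.Dual K F, ∀ x, ℓ x = 2⁻¹ * QuadraticMap.polar Q v (ρ x v) :=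
    ⟨(2⁻¹ : K) • (QuadraticMap.polarBilin Q v).comp L, fun x => by
      rw [LinearMap.smul_apply, LinearMap.comp_apply, hL, smul_eq_mul,
        QuadraticMap.polarBilin_apply_apply]⟩
  have hℓ : ∀ x, Q (e x) = ℓ (x ^ 2) := by
    intro x
    rw [hℓ', pow_two, map_mul, Module.End.mul_apply, ← hadj, ← he, QuadraticMap.polar_self,
      nsmul_eq_mul, Nat.cast_ofNat, ← mul_assoc, inv_mul_cancel₀ h2, one_mul]
  have hnd := traceForm_nondegenerate K F
  obtain ⟨α, hα⟩ : ∃ α, ∀ x, ℓ x = Algebra.trace K F (α * x) :=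
    ⟨((Algebra.traceForm K F).toDual hnd).symm ℓ, fun x =>
      (LinearMap.BilinForm.apply_toDual_symm_apply (hB := hnd) ℓ x).symm⟩
  have hQα : ∀ x, Q (e x) = scaledTraceForm K F α x := by
    intro x
    rw [hℓ, hα, scaledTraceForm_apply]
  have hα0 : α ≠ 0 := by
    rintro rfl
    apply hQ
    ext w
    obtain ⟨x, rfl⟩ := e.surjective w
    rw [hQα, scaledTraceForm_apply, zero_mul, map_zero, zero_apply]
  exact ⟨F, inferInstance, inferInstance, inferInstance, inferInstance, α, hα0,
    ⟨QuadraticMap.IsometryEquiv.symm ⟨e, fun x => (hQα x)⟩⟩⟩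

theorem polar_aeval_left {K V : Type*} [Field K] [AddCommGroup V] [Module K V]
    (Q : QuadraticForm K V) (T : Module.End K V)
    (hT : ∀ x y, QuadraticMap.polar Q (T x) y = QuadraticMap.polar Q x (T y)) (p : K[X])
    (u w : V) :
    QuadraticMap.polar Q (aeval T p u) w = QuadraticMap.polar Q u (aeval T p w) := by
  induction p using Polynomial.induction_on' generalizing u w with
  | add p q hp hq =>
    simp only [map_add, LinearMap.add_apply, QuadraticMap.polar_add_left,
      QuadraticMap.polar_add_right, hp, hq]
  | monomial m c =>
    have hpow : ∀ m u w, QuadraticMap.polar Q ((T ^ m) u) w =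
        QuadraticMap.polar Q u ((T ^ m) w) := by
      intro m
      induction m with
      | zero => intro u w; simp
      | succ m ih =>
        intro u w
        rw [pow_succ, Module.End.mul_apply, ih, hT, ← Module.End.mul_apply, ← pow_succ',
          ← pow_succ]
    simp only [aeval_monomial, Module.End.mul_apply, Module.algebraMap_end_apply,
      QuadraticMap.polar_smul_left, QuadraticMap.polar_smul_right, hpow]

/-- By Cayley–Hamilton K[X]/(χ_T) acts on V; it is a field of degree dim V, and polynomials in T
remain self-adjoint. -/
theorem isIsomorphicToScaledTraceForm_of_selfAdjoint {K : Type*} {V : Type*} [Field K]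
    (h2 : (2 : K) ≠ 0) [AddCommGroup V] [Module K V] [FiniteDimensional K V]
    (Q : QuadraticForm K V) (hQ : Q ≠ 0) (T : Module.End K V)
    (hT : ∀ x y, QuadraticMap.polar Q (T x) y = QuadraticMap.polar Q x (T y))
    (hirr : Irreducible T.charpoly) (hsep : T.charpoly.Separable) :
    IsIsomorphicToScaledTraceForm Q := by
  have : Fact (Irreducible T.charpoly) := ⟨hirr⟩
  have hfin : FiniteDimensional K (AdjoinRoot T.charpoly) :=
    (LinearMap.charpoly_monic T).finite_adjoinRoot
  have hFsep := isSeparable_adjoinRoot hsep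
  let ρ : AdjoinRoot T.charpoly →ₐ[K] Module.End K V :=
    Ideal.Quotient.liftₐ (Ideal.span {T.charpoly}) (aeval T) (by
      intro p hp
      obtain ⟨q, rfl⟩ := Ideal.mem_span_singleton.1 hp
      rw [map_mul, LinearMap.aeval_self_charpoly, zero_mul])
  refine isIsomorphicToScaledTraceForm_of_field h2 Q hQ ρ (fun x => ?_) ?_
  · induction x using AdjoinRoot.induction_on with | ih p
    exact polar_aeval_left Q T hT p
  · rw [(AdjoinRoot.powerBasis hirr.ne_zero).finrank, AdjoinRoot.powerBasis_dim,
      LinearMap.charpoly_natDegree]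

/-! ### Rank one perturbations of diagonal matrices; separable specializations -/

theorem det_diagonal_sub_vecMulVec {F : Type*} [Field F] {n : ℕ} (d u w : Fin n → F)
    (hd : ∀ i, d i ≠ 0) : (Matrix.diagonal d - Matrix.vecMulVec u w).det =
      ∏ i, d i - ∑ i, u i * w i * ∏ j ∈ Finset.univ.erase i, d j := by
  have hdet : (Matrix.diagonal d).det = ∏ i, d i := Matrix.det_diagonal
  have hdet0 : ∏ i, d i ≠ 0 := Finset.prod_ne_zero_iff.2 fun i _ => hd i
  have hinv : (Matrix.diagonal d)⁻¹ = Matrix.diagonal fun i => (d i)⁻¹ := by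
    apply Matrix.inv_eq_right_inv
    rw [Matrix.diagonal_mul_diagonal, ← Matrix.diagonal_one]
    congr 1
    funext i
    exact mul_inv_cancel₀ (hd i)
  have h1 : Matrix.diagonal d - Matrix.vecMulVec u w = Matrix.diagonal d +
      Matrix.replicateCol Unit (fun i => -u i) * Matrix.replicateRow Unit w := by
    ext i j
    simp [Matrix.vecMulVec_apply, Matrix.mul_apply, sub_eq_add_neg]
  rw [h1, Matrix.det_add_replicateCol_mul_replicateRow (by rw [hdet]; exact hdet0.isUnit), hdet,
    hinv, Matrix.det_unique]
  rw [Matrix.add_apply, Matrix.one_apply_eq, Matrix.mul_apply]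
  simp only [Matrix.mul_diagonal, Matrix.replicateRow_apply, Matrix.replicateCol_apply]
  rw [mul_add, mul_one, sub_eq_add_neg, ← Finset.sum_neg_distrib, Finset.mul_sum]
  congr 1
  refine Finset.sum_congr rfl fun i _ => ?_
  rw [← Finset.mul_prod_erase Finset.univ d (Finset.mem_univ i)]
  field_simp [hd i]

/-- The matrix determinant lemma over the fraction field of R[X], where the entries X - d_i are
nonzero. -/
theorem charpoly_diagonal_add_vecMulVec {R : Type*} [CommRing R] [IsDomain R] {n : ℕ}
    (d u w : Fin n → R) : (Matrix.diagonal d + Matrix.vecMulVec u w).charpoly =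
      ∏ i, (X - C (d i)) - ∑ i, C (u i * w i) * ∏ j ∈ Finset.univ.erase i, (X - C (d j)) := by
  have hinj := IsFractionRing.injective R[X] (FractionRing R[X])
  apply hinj
  rw [Matrix.charpoly, RingHom.map_det]
  have h1 : (algebraMap R[X] (FractionRing R[X])).mapMatrix
      (Matrix.charmatrix (Matrix.diagonal d + Matrix.vecMulVec u w)) =
      Matrix.diagonal (fun i => algebraMap R[X] (FractionRing R[X]) (X - C (d i))) -
        Matrix.vecMulVec (fun i => algebraMap R[X] (FractionRing R[X]) (C (u i)))
          (fun i => algebraMap R[X] (FractionRing R[X]) (C (w i))) := by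
    ext i j
    by_cases hij : i = j
    · subst hij
      simp [Matrix.vecMulVec_apply]
      ring
    · simp [Matrix.vecMulVec_apply, hij]
  rw [h1, det_diagonal_sub_vecMulVec]
  · simp [map_sub, map_prod, map_sum]
  · intro i
    rw [Ne, map_eq_zero_iff _ hinj]
    exact X_sub_C_ne_zero _

/-- All but finitely many specializations of a separable irreducible polynomial are separable. -/
theorem finite_setOf_not_separable {k : Type*} [Field k] {P : k[X][Y]} (hP : P.Monic)
    (hirr : Irreducible P) (hder : derivative P ≠ 0) :
    {a : k | ¬ (P.map (evalRingHom a)).Separable}.Finite := by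
  classical
  have hinj := IsFractionRing.injective k[X] (RatFunc k)
  have hirr' : Irreducible (P.map (algebraMap k[X] (RatFunc k))) :=
    (hP.irreducible_iff_irreducible_map_fraction_map).1 hirr
  have hsep : (P.map (algebraMap k[X] (RatFunc k))).Separable := by
    rw [separable_iff_derivative_ne_zero hirr', derivative_map]
    exact (Polynomial.map_ne_zero_iff hinj).2 hder
  have hpos : P.natDegree ≠ 0 := fun h => hirr.ne_one (hP.natDegree_eq_zero.1 h)
  have hr : P.resultant (derivative P) ≠ 0 := by
    intro h
    have h1 := resultant_map_map P (derivative P) P.natDegree (derivative P).natDegree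
      (algebraMap k[X] (RatFunc k))
    rw [h, map_zero] at h1
    have h2 : (P.map (algebraMap k[X] (RatFunc k))).resultant
        ((derivative P).map (algebraMap k[X] (RatFunc k))) = 0 := by
      rw [natDegree_map_eq_of_injective hinj, natDegree_map_eq_of_injective hinj, h1]
    rw [resultant_eq_zero_iff] at h2
    rw [separable_def, derivative_map] at hsep
    exact h2.2 hsep
  -- The Bézout identity for the resultant specializes well even if the degree of the derivative
  -- drops at a.
  obtain ⟨p, q, -, -, hpq⟩ := exists_mul_add_mul_eq_C_resultant P (derivative P) le_rfl le_rfl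
    (Or.inl hpos)
  refine (P.resultant (derivative P)).roots.toFinset.finite_toSet.subset fun a ha => ?_
  simp only [Finset.mem_coe, Multiset.mem_toFinset, mem_roots hr, IsRoot]
  by_contra hne
  apply ha
  have h1 := congrArg (Polynomial.map (evalRingHom a)) hpq
  simp only [Polynomial.map_add, Polynomial.map_mul, map_C, coe_evalRingHom] at h1
  rw [separable_def, derivative_map]
  refine ⟨C (eval a (P.resultant (derivative P)))⁻¹ * p.map (evalRingHom a),
    C (eval a (P.resultant (derivative P)))⁻¹ * q.map (evalRingHom a), ?_⟩
  have h2 : C (eval a (P.resultant (derivative P)))⁻¹ * C (eval a (P.resultant (derivative P))) =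
      (1 : k[X]) := by
    rw [← C_mul, inv_mul_cancel₀ hne, C_1]
  rw [← h2, ← h1]
  ring

/-- The family of matrices `diag(λ) + t b w wᵀ`. -/
def rankOneFamily {R : Type*} [CommRing R] {n : ℕ} (b lam w : Fin n → R) (t : R) :
    Matrix (Fin n) (Fin n) R :=
  Matrix.diagonal lam + Matrix.vecMulVec (fun i => t * (b i * w i)) w

theorem map_rankOneFamily {R S : Type*} [CommRing R] [CommRing S] {n : ℕ} (b lam w : Fin n → R)
    (t : R) (f : R →+* S) :
    (rankOneFamily b lam w t).map f = rankOneFamily (f ∘ b) (f ∘ lam) (f ∘ w) (f t) := by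
  ext i j
  by_cases hij : i = j
  · subst hij
    simp [rankOneFamily, Matrix.vecMulVec_apply]
  · simp [rankOneFamily, Matrix.vecMulVec_apply, hij]

/-! ### Realizing the pencil by a rank one family -/

section existence

variable {k : Type*} [Field k] [IsAlgClosed k]

theorem exists_double_root_polynomial {n : ℕ} (hn : 2 ≤ n) :
    ∃ g m : k[X], g.Monic ∧ g.natDegree = n ∧ g = (X - 1) ^ 2 * m ∧ m.Separable ∧
      m.eval 1 ≠ 0 ∧ m.eval 0 ≠ 0 := by
  classical
  have hinf : (({0, 1} : Set k)ᶜ).Infinite := (Set.toFinite {0, 1}).infinite_compl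
  obtain ⟨s, hs, hcard⟩ := hinf.exists_subset_card_eq (n - 2)
  have hmon : (∏ c : s, (X - C (c : k))).Monic := monic_prod_of_monic _ _ fun _ _ => monic_X_sub_C _
  have hX1 : ((X - 1 : k[X]) ^ 2).Monic := by simpa using (monic_X_sub_C (1 : k)).pow 2
  have hne : ∀ a ∈ ({0, 1} : Set k), (∏ c : s, (X - C (c : k))).eval a ≠ 0 := by
    intro a ha
    rw [eval_prod, Finset.prod_ne_zero_iff]
    rintro ⟨c, hc⟩ - h
    rw [eval_sub, eval_X, eval_C, sub_eq_zero] at h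
    have h' : a = c := h
    exact hs hc (h' ▸ ha)
  refine ⟨(X - 1) ^ 2 * ∏ c : s, (X - C (c : k)), ∏ c : s, (X - C (c : k)), hX1.mul hmon, ?_, rfl,
    separable_prod_X_sub_C_iff.2 Subtype.val_injective, hne 1 (by simp), hne 0 (by simp)⟩
  rw [hX1.natDegree_mul hmon, natDegree_pow, ← C_1, natDegree_X_sub_C,
    natDegree_finsetProd_X_sub_C_eq_card, Finset.card_univ, Fintype.card_coe, hcard]
  omega

/-- A multiple root y of g - τX satisfies g(y) = y g'(y) and τ = g'(y), so only finitely many τ are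
excluded. -/
theorem exists_separable_shift {g : k[X]} (h0 : g.eval 0 ≠ 0) :
    ∃ τ : k, (g - C τ * X).Separable := by
  classical
  have hne : g - X * derivative g ≠ 0 := by
    intro h
    have := congrArg (eval 0) h
    simp at this
    exact h0 this
  obtain ⟨τ, hτ⟩ := ((g - X * derivative g).roots.toFinset.image
    fun y => (derivative g).eval y).exists_notMem
  refine ⟨τ, ?_⟩
  rw [separable_def, isCoprime_iff_aeval_ne_zero_of_isAlgClosed k k]
  intro y
  by_contra! h
  obtain ⟨h1, h2⟩ := h
  simp only [coe_aeval_eq_eval, eval_sub, eval_mul, eval_C, eval_X, derivative_sub,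
    derivative_C_mul_X, sub_eq_zero] at h1 h2
  apply hτ
  refine Finset.mem_image.2 ⟨y, ?_, h2⟩
  rw [Multiset.mem_toFinset, mem_roots hne, IsRoot, eval_sub, eval_mul, eval_X, h1, h2]
  ring

/-- Take for λ the roots of g - τX. The coefficient of -t in the characteristic polynomial is ∑ b_i
w_i² ∏_{j≠i} (Y - λ_j). By Lagrange interpolation it equals Y when w_i² = λ_i / (b_i ∏_{j≠i} (λ_i -
λ_j)); square roots exist, and deg Y < n as n ≥ 2. -/
theorem exists_rankOneFamily_charpoly {g : k[X]} (hg : g.Monic) {n : ℕ} (hgn : g.natDegree = n)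
    (hn : 2 ≤ n) {τ : k} (hτ : (g - C τ * X).Separable) {b : Fin n → k} (hb : ∀ i, b i ≠ 0) :
    ∃ lam w : Fin n → k, (rankOneFamily (fun i => C (b i)) (fun i => C (lam i))
      (fun i => C (w i)) (X : k[X])).charpoly = g.map C - C (C τ + X) * X := by
  classical
  have hmon := monic_pencil (k := k) (Ω := k) (t := τ) hg (by omega)
  have hdeg := natDegree_pencil (k := k) (Ω := k) (t := τ) (g := g) (by omega)
  rw [Algebra.algebraMap_self, Polynomial.map_id] at hmon hdeg
  obtain ⟨r, hr, hprod⟩ := exists_injective_prod_X_sub_C hmon hτ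
  obtain ⟨lam, hlam, hprod⟩ : ∃ lam : Fin n → k, Function.Injective lam ∧
      g - C τ * X = ∏ i, (X - C (lam i)) := by
    have hcard : n = (g - C τ * X).natDegree := by rw [hdeg, hgn]
    refine ⟨r ∘ Fin.cast hcard, hr.comp (Fin.cast_injective _), hprod.trans ?_⟩
    exact (Fintype.prod_equiv (finCongr hcard) _ _ fun i => rfl).symm
  have hD : ∀ i, ∏ j ∈ Finset.univ.erase i, (lam i - lam j) ≠ 0 := fun i =>
    Finset.prod_ne_zero_iff.2 fun j hj =>
      sub_ne_zero.2 (hlam.ne (Finset.ne_of_mem_erase hj).symm)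
  choose w hw using fun i => IsAlgClosed.exists_eq_mul_self
    (lam i / (b i * ∏ j ∈ Finset.univ.erase i, (lam i - lam j)))
  have hX : ∑ i, C (b i * w i * w i) * ∏ j ∈ Finset.univ.erase i, (X - C (lam j)) = (X : k[X]) := by
    refine eq_of_degrees_lt_of_eval_index_eq (v := lam) Finset.univ hlam.injOn ?_ ?_ ?_
    · refine (degree_sum_le _ _).trans_lt ?_
      rw [Finset.sup_lt_iff]
      · intro i _
        refine (degree_mul_le _ _).trans_lt ?_
        rw [degree_prod]
        simp only [degree_X_sub_C, Finset.sum_const, Finset.card_erase_of_mem (Finset.mem_univ i),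
          Finset.card_univ, Fintype.card_fin, nsmul_eq_mul, mul_one]
        refine (add_le_add_left degree_C_le _).trans_lt ?_
        rw [zero_add]
        exact_mod_cast (by omega : n - 1 < n)
      · rw [Finset.card_univ, Fintype.card_fin]; exact WithBot.bot_lt_coe n
    · rw [degree_X, Finset.card_univ, Fintype.card_fin]
      exact_mod_cast (by omega : 1 < n)
    · intro i _
      rw [eval_finsetSum, Finset.sum_eq_single i]
      · rw [eval_mul, eval_C, eval_prod, eval_X, mul_assoc (b i), ← hw]
        simp only [eval_sub, eval_X, eval_C]
        have := hD i
        have := hb i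
        field_simp
      · intro j _ hji
        rw [eval_mul, eval_prod, Finset.prod_eq_zero (Finset.mem_erase.2 ⟨hji.symm, Finset.mem_univ i⟩),
          mul_zero]
        simp
      · simp
  refine ⟨lam, w, ?_⟩
  rw [rankOneFamily, charpoly_diagonal_add_vecMulVec]
  have h1 : ∏ i, (X - C (C (lam i)) : k[X][Y]) = (g - C τ * X).map C := by
    rw [hprod, Polynomial.map_prod]
    simp
  have h2 : ∑ i, C (X * (C (b i) * C (w i)) * C (w i)) *
      ∏ j ∈ Finset.univ.erase i, (X - C (C (lam j)) : k[X][Y]) = C X * X := by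
    have hX' := congrArg (Polynomial.map (C : k →+* k[X])) hX
    rw [map_X, Polynomial.map_sum] at hX'
    refine Eq.trans ?_ (congrArg (C X * ·) hX')
    rw [Finset.mul_sum]
    refine Finset.sum_congr rfl fun i _ => ?_
    rw [Polynomial.map_mul, Polynomial.map_prod]
    simp only [Polynomial.map_sub, Polynomial.map_mul, map_X, map_C, C_mul]
    ring
  rw [h1, h2]
  simp only [Polynomial.map_sub, Polynomial.map_mul, map_C, map_X, C_add]
  ring

end existence

/-! ### Generic absolute irreducibility of the resolvent -/

/-- Some element of `N` is the coefficient vector of a linear form separating the permutations of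
given distinct elements. -/
theorem exists_injective_sum_embeddings {M N E L : Type*} [Field M] [Infinite M] [Field N]
    [Algebra M N] [Field E] [Algebra M E] [Field L] [Algebra M L] [Algebra E L]
    [IsScalarTower M E L] [Fintype (N →ₐ[M] E)] {x : (N →ₐ[M] E) → L}
    (hx : Function.Injective x) :
    ∃ δ : N, Function.Injective fun σ : Equiv.Perm (N →ₐ[M] E) =>
      ∑ φ : N →ₐ[M] E, algebraMap E L (φ δ) * x (σ φ) := by
  classical
  -- `W p` consists of the δ that fail to separate the pair p. It is a proper subspace by
  -- independence of characters, and finitely many proper subspaces do not cover N over an infinite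
  -- field.
  let W : Equiv.Perm (N →ₐ[M] E) × Equiv.Perm (N →ₐ[M] E) → Subspace M N := fun p =>
    LinearMap.ker (∑ φ : N →ₐ[M] E,
      (x (p.1 φ) - x (p.2 φ)) • ((IsScalarTower.toAlgHom M E L).comp φ).toLinearMap)
  have hW : ∀ p δ, δ ∈ W p ↔ ∑ φ : N →ₐ[M] E, algebraMap E L (φ δ) * x (p.1 φ) =
      ∑ φ : N →ₐ[M] E, algebraMap E L (φ δ) * x (p.2 φ) := by
    intro p δ
    rw [← sub_eq_zero, ← Finset.sum_sub_distrib, LinearMap.mem_ker, LinearMap.sum_apply]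
    simp only [LinearMap.smul_apply, AlgHom.toLinearMap_apply, AlgHom.comp_apply,
      IsScalarTower.coe_toAlgHom', smul_eq_mul]
    rw [Finset.sum_congr rfl fun φ _ => _]
    intro φ _
    ring
  have hli : LinearIndependent L fun φ : N →ₐ[M] E => fun z : N => algebraMap E L (φ z) := by
    refine (linearIndependent_monoidHom N L).comp
      (fun φ : N →ₐ[M] E => (((algebraMap E L : E →+* L).comp φ.toRingHom : N →+* L) : N →* L)) ?_
    intro φ ψ h
    ext z
    exact (algebraMap E L).injective (DFunLike.congr_fun h z)
  have hproper : ∀ p, p.1 ≠ p.2 → W p ≠ ⊤ := by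
    intro p hp htop
    apply hp
    ext1 φ
    have h1 := Fintype.linearIndependent_iff.1 hli (fun φ => x (p.1 φ) - x (p.2 φ)) (by
      funext z
      have h2 := (hW p z).1 (htop ▸ Submodule.mem_top)
      rw [← sub_eq_zero, ← Finset.sum_sub_distrib] at h2
      rw [Finset.sum_apply, Pi.zero_apply, ← h2]
      refine Finset.sum_congr rfl fun φ _ => ?_
      simp only [Pi.smul_apply, smul_eq_mul]
      ring) φ
    exact hx (sub_eq_zero.1 h1)
  have hun := Subspace.biUnion_ne_univ_of_top_notMem
    (s := (Finset.univ.filter fun p : _ × _ => p.1 ≠ p.2).image W) (by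
      intro h
      obtain ⟨p, hp, h⟩ := Finset.mem_image.1 h
      exact hproper p (Finset.mem_filter.1 hp).2 h)
  obtain ⟨δ, hδ⟩ := (Set.ne_univ_iff_exists_notMem _).1 hun
  refine ⟨δ, fun σ τ h => ?_⟩
  by_contra hne
  apply hδ
  rw [Set.mem_iUnion₂]
  exact ⟨W (σ, τ), Finset.mem_image_of_mem _ (by simpa using hne), (hW (σ, τ) δ).2 h⟩

/-- The roots of the resolvent are distinct and indexed by permutations; as every permutation of the
x_i is induced by an automorphism fixing E, any root is carried to any other. -/
theorem irreducible_specialize_pencil {M E Ω ι : Type*} [Field M] [Field E] [IsAlgClosed E]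
    [Algebra M E] [Field Ω] [IsAlgClosed Ω] [Algebra E Ω] [Algebra E[X] Ω] [IsScalarTower E E[X] Ω]
    [FaithfulSMul E[X] Ω] [Algebra.IsAlgebraic E[X] Ω] [Fintype ι] [DecidableEq ι]
    {g m : E[X]} (hg : g.Monic) (hn : 2 ≤ g.natDegree) (hgm : g = (X - 1) ^ 2 * m)
    (hm : m.Separable) (hm1 : m.eval 1 ≠ 0) (hm0 : m.eval 0 ≠ 0) {x : ι → Ω}
    (hx : Function.Injective x) (hcard : Fintype.card ι = g.natDegree)
    (hroots : g.map (algebraMap E Ω) - C (algebraMap E[X] Ω X) * X = ∏ i, (X - C (x i)))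
    {d : ι → E}
    (hinj : Function.Injective fun σ : Equiv.Perm ι => ∑ i, algebraMap E Ω (d i) * x (σ i))
    {Q : Polynomial (MvPolynomial (Fin g.natDegree) M)} (hQm : Q.Monic)
    (hQ : Q.map (MvPolynomial.eval₂Hom (MvPolynomial.C.comp (algebraMap M E))
        (fun i : Fin g.natDegree => MvPolynomial.esymm ι E (i + 1))) = genericResolvent d)
    (τ : E) :
    Irreducible (specialize Q (C.comp (algebraMap M E)) (g.map C - C (C τ + X) * X)) ∧
      derivative (specialize Q (C.comp (algebraMap M E)) (g.map C - C (C τ + X) * X)) ≠ 0 := by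
  -- The translation t ↦ t - τ absorbs the shift and turns the polynomial into the pencil over t.
  obtain ⟨θ, hθC, hθX⟩ : ∃ θ : E[X] →+* Ω, θ.comp C = algebraMap E Ω ∧
      θ X = algebraMap E[X] Ω X - algebraMap E Ω τ :=
    ⟨eval₂RingHom (algebraMap E Ω) (algebraMap E[X] Ω X - algebraMap E Ω τ), by ext; simp,
      by simp⟩
  have hθ : ∀ a, θ (C a) = algebraMap E Ω a := fun a => by rw [← hθC]; rfl
  have hmap : (specialize Q (C.comp (algebraMap M E)) (g.map C - C (C τ + X) * X)).map θ =
      ∏ σ : Equiv.Perm ι, (X - C (∑ i, algebraMap E Ω (d i) * x (σ i))) := by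
    rw [map_specialize, ← RingHom.comp_assoc, hθC]
    refine specialize_eq_prod hcard hQ (algebraMap E Ω) x ?_
    rw [← hroots]
    simp only [Polynomial.map_sub, Polynomial.map_mul, map_X, map_add, Polynomial.map_map, hθC,
      Polynomial.map_add, map_C, hθ, hθX, C_sub]
    ring
  refine ⟨irreducible_of_conjugate_roots θ (monic_specialize hQm _ _) _ hinj hmap ?_, ?_⟩
  · intro σ σ'
    let e : ι ≃ Fin g.natDegree := Fintype.equivFinOfCardEq hcard
    obtain ⟨γ, hγ⟩ := exists_algEquiv_perm_roots hg hn hgm hm hm1 hm0 (x ∘ e.symm)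
      (hx.comp e.symm.injective)
      (hroots.trans (Fintype.prod_equiv e _ _ fun i => by simp))
      (e.symm.trans ((σ' * σ⁻¹ : Equiv.Perm ι).trans e))
    have hγE : ∀ a, γ (algebraMap E Ω a) = algebraMap E Ω a := fun a => by
      rw [IsScalarTower.algebraMap_apply E E[X] Ω, γ.commutes]
    have hγx : ∀ i, γ (x i) = x (σ' (σ⁻¹ i)) := fun i => by simpa using hγ (e i)
    refine ⟨γ.toRingEquiv.toRingHom, ?_, ?_⟩
    · apply Polynomial.ringHom_ext
      · intro a
        change γ (θ (C a)) = θ (C a)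
        rw [hθ, hγE]
      · change γ (θ X) = θ X
        rw [hθX, map_sub, γ.commutes, hγE]
    · change γ (∑ i, algebraMap E Ω (d i) * x (σ i)) = _
      rw [map_sum]
      refine Finset.sum_congr rfl fun i _ => ?_
      rw [map_mul, hγE, hγx]
      simp
  · intro h
    have h1 := separable_prod_X_sub_C_iff.2 hinj
    rw [← hmap, separable_def, derivative_map, h, Polynomial.map_zero, isCoprime_zero_right,
      hmap] at h1
    have h2 := natDegree_eq_zero_of_isUnit h1
    rw [natDegree_finsetProd_X_sub_C_eq_card, Finset.card_univ] at h2
    exact Fintype.card_ne_zero h2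

/-- The resolvent of the characteristic polynomials of a rank one family of matrices. -/
noncomputable def familyResolvent {M B : Type*} [CommRing M] [CommRing B] {n : ℕ}
    (Q : Polynomial (MvPolynomial (Fin n) M)) (ψ : M →+* B) (b : Fin n → B)
    (s : Fin n ⊕ Fin n → B) : B[X][Y] :=
  specialize Q (C.comp ψ) (rankOneFamily (fun i => C (b i)) (fun i => C (s (Sum.inl i)))
    (fun i => C (s (Sum.inr i))) (X : B[X])).charpoly

section familyResolvent

variable {M B B' : Type*} [CommRing M] [CommRing B] [CommRing B'] {n : ℕ}
  (Q : Polynomial (MvPolynomial (Fin n) M)) (ψ : M →+* B) (b : Fin n → B) (s : Fin n ⊕ Fin n → B)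

theorem map_familyResolvent (f : B →+* B') :
    (familyResolvent Q ψ b s).map (mapRingHom f) = familyResolvent Q (f.comp ψ) (f ∘ b) (f ∘ s) := by
  rw [familyResolvent, familyResolvent, map_specialize, ← Matrix.charpoly_map, map_rankOneFamily]
  congr 1
  · ext; simp
  · congr 1
    congr 1 <;> first | (funext i; simp) | simp

theorem map_evalRingHom_familyResolvent (a : B) :
    (familyResolvent Q ψ b s).map (evalRingHom a) =
      specialize Q ψ (rankOneFamily b (s ∘ Sum.inl) (s ∘ Sum.inr) a).charpoly := by
  rw [familyResolvent, map_specialize, ← Matrix.charpoly_map, map_rankOneFamily]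
  congr 1
  · ext; simp
  · congr 1
    congr 1 <;> first | (funext i; simp) | simp

end familyResolvent

section generic

variable {M N E : Type*} [Field M] [Infinite M] [Field N] [Algebra M N] [Field E] [Algebra M E]
  [IsAlgClosed E] [Algebra.IsAlgebraic M E] [Algebra.IsSeparable M N] [Fintype (N →ₐ[M] E)]
  [DecidableEq (N →ₐ[M] E)]

/-- This is the one good point in parameter space that openness requires; δ is chosen to separate
the permutations of the roots of the pencil. -/
theorem exists_irreducible_familyResolvent {n : ℕ} (hcard : Fintype.card (N →ₐ[M] E) = n)
    (hn : 2 ≤ n) {b : Fin n → E} (hb : ∀ i, b i ≠ 0) :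
    ∃ (δ : N) (Q : Polynomial (MvPolynomial (Fin n) M)) (s : Fin n ⊕ Fin n → E), Q.Monic ∧
      Q.map (MvPolynomial.eval₂Hom (MvPolynomial.C.comp (algebraMap M E))
        (fun i : Fin n => MvPolynomial.esymm (N →ₐ[M] E) E (i + 1))) =
        genericResolvent (fun φ => φ δ) ∧
      Irreducible (familyResolvent Q (algebraMap M E) b s) ∧
      derivative (familyResolvent Q (algebraMap M E) b s) ≠ 0 := by
  obtain ⟨g, m, hg, hgn, hgm, hm, hm1, hm0⟩ := exists_double_root_polynomial (k := E) hn
  subst hgn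
  have hg0 : g.eval 0 ≠ 0 := by rw [hgm]; simpa using hm0
  obtain ⟨τ, hτ⟩ := exists_separable_shift hg0
  obtain ⟨lam, w, hlw⟩ := exists_rankOneFamily_charpoly hg rfl hn hτ hb
  let Ω := AlgebraicClosure (FractionRing E[X])
  have hXinj : Function.Injective (algebraMap E[X] Ω) := by
    rw [IsScalarTower.algebraMap_eq E[X] (FractionRing E[X]) Ω]
    exact (algebraMap (FractionRing E[X]) Ω).injective.comp (IsFractionRing.injective _ _)
  have : FaithfulSMul E[X] Ω := (faithfulSMul_iff_algebraMap_injective _ _).2 hXinj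
  have : Algebra.IsAlgebraic E[X] Ω :=
    (IsFractionRing.comap_isAlgebraic_iff (A := E[X]) (K := FractionRing E[X])).2 inferInstance
  have ht : algebraMap E[X] Ω X ∉ Set.range (algebraMap E Ω) := by
    rintro ⟨c, hc⟩
    rw [IsScalarTower.algebraMap_apply E E[X] Ω] at hc
    exact X_ne_C c (hXinj hc).symm
  obtain ⟨r, hr, hprod⟩ := exists_injective_prod_X_sub_C
    (monic_pencil (k := E) (Ω := Ω) (t := algebraMap E[X] Ω X) hg hn) (separable_pencil hg0 ht)
  have hdeg := natDegree_pencil (k := E) (Ω := Ω) (t := algebraMap E[X] Ω X) hn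
  let e := Fintype.equivFinOfCardEq (hcard.trans hdeg.symm)
  have hx : Function.Injective (r ∘ e) := hr.comp e.injective
  have hroots := hprod.trans (Fintype.prod_equiv e (fun φ => X - C ((r ∘ e) φ)) _
    fun φ => rfl).symm
  obtain ⟨δ, hδ⟩ := exists_injective_sum_embeddings (M := M) (N := N) (E := E) hx
  obtain ⟨Q, hQm, hQ⟩ := exists_descended_resolvent hcard δ
  refine ⟨δ, Q, Sum.elim lam w, hQm, hQ, ?_⟩
  have := irreducible_specialize_pencil hg hn hgm hm hm1 hm0 hx hcard hroots hδ hQm hQ τ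
  rw [← hlw] at this
  exact this

/-- Generically, the resolvent of a rank one family is irreducible and separable. -/
theorem exists_generic_irreducible_familyResolvent {n : ℕ}
    (hcard : Fintype.card (N →ₐ[M] E) = n) (hn : 2 ≤ n) {b : Fin n → E} (hb : ∀ i, b i ≠ 0) :
    ∃ (δ : N) (Q : Polynomial (MvPolynomial (Fin n) M)) (Δ : MvPolynomial (Fin n ⊕ Fin n) E),
      Q.Monic ∧
      Q.map (MvPolynomial.eval₂Hom (MvPolynomial.C.comp (algebraMap M E))
        (fun i : Fin n => MvPolynomial.esymm (N →ₐ[M] E) E (i + 1))) =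
        genericResolvent (fun φ => φ δ) ∧ Δ ≠ 0 ∧
      ∀ s, MvPolynomial.eval s Δ ≠ 0 →
        Irreducible (familyResolvent Q (algebraMap M E) b s) ∧
        derivative (familyResolvent Q (algebraMap M E) b s) ≠ 0 := by
  obtain ⟨δ, Q, s₀, hQm, hQ, hirr, hder⟩ := exists_irreducible_familyResolvent hcard hn hb
  -- P is the resolvent with indeterminate λ and w.
  obtain ⟨P, hP, hPs⟩ : ∃ P : (MvPolynomial (Fin n ⊕ Fin n) E)[X][Y], P.Monic ∧
      ∀ s, P.map (mapRingHom (MvPolynomial.eval s)) = familyResolvent Q (algebraMap M E) b s := by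
    refine ⟨familyResolvent Q (MvPolynomial.C.comp (algebraMap M E)) (MvPolynomial.C ∘ b)
      MvPolynomial.X, monic_specialize hQm _ _, fun s => ?_⟩
    rw [map_familyResolvent]
    congr 1
    · ext; simp
    · funext i; simp
    · funext i; simp
  rw [← hPs] at hirr hder
  obtain ⟨Δ, hΔ, hΔirr⟩ := exists_eval_ne_zero_imp_irreducible hP s₀ hirr
  -- A coefficient of the derivative that is nonzero at s₀ provides the second open condition.
  obtain ⟨i, hi⟩ : ∃ i, (derivative (P.map (mapRingHom (MvPolynomial.eval s₀)))).coeff i ≠ 0 := by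
    by_contra! h
    exact hder (Polynomial.ext h)
  obtain ⟨j, hj⟩ : ∃ j,
      ((derivative (P.map (mapRingHom (MvPolynomial.eval s₀)))).coeff i).coeff j ≠ 0 := by
    by_contra! h
    exact hi (Polynomial.ext h)
  have hc : ∀ s, ((derivative (P.map (mapRingHom (MvPolynomial.eval s)))).coeff i).coeff j =
      MvPolynomial.eval s (((derivative P).coeff i).coeff j) := by
    intro s
    rw [derivative_map, coeff_map, coe_mapRingHom, coeff_map]
  refine ⟨δ, Q, Δ * ((derivative P).coeff i).coeff j, hQm, hQ, ?_, fun s hs => ?_⟩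
  · intro h
    have := congrArg (MvPolynomial.eval s₀) h
    rw [map_mul, map_zero, ← hc] at this
    exact mul_ne_zero hΔ hj this
  · rw [map_mul, ← hc] at hs
    rw [← hPs]
    refine ⟨hΔirr s (left_ne_zero_of_mul hs), fun h => right_ne_zero_of_mul hs ?_⟩
    rw [h, coeff_zero, coeff_zero]

end generic

/-! ### Applying the PAC property -/

theorem exists_eq_prod_X_sub_C {E ι : Type*} [Field E] [IsAlgClosed E] [Fintype ι] {f : E[X]}
    (hf : f.Monic) (hcard : Fintype.card ι = f.natDegree) :
    ∃ x : ι → E, f = ∏ i, (X - C (x i)) := by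
  have h1 := (IsAlgClosed.splits f).eq_prod_roots_of_monic hf
  have h2 : f.roots.toList.length = Fintype.card ι := by
    rw [Multiset.length_toList, hcard, ← (IsAlgClosed.splits f).natDegree_eq_card_roots]
  let e : ι ≃ Fin f.roots.toList.length := Fintype.equivFinOfCardEq h2.symm
  refine ⟨fun i => f.roots.toList.get (e i), ?_⟩
  rw [Equiv.prod_comp e fun j => X - C (f.roots.toList.get j), ← List.prod_ofFn]
  conv_lhs => rw [h1, ← Multiset.coe_toList f.roots, Multiset.map_coe, Multiset.prod_coe]
  congr 1
  apply List.ext_get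
  · simp
  · intro i h3 h4
    simp

/-- The polynomial f = Y has zero set K × {0}. -/
theorem infinite_of_isPACExtension {K M : Type*} [Field K] [Field M] [Algebra K M]
    (hM : IsPACExtension K M) : Infinite K := by
  by_contra hK
  rw [not_infinite_iff_finite] at hK
  refine hM (X : M[X][Y]) ?_ (by simp) ?_
  · rw [IsAbsolutelyIrreducible, map_X]
    exact irreducible_X
  · refine ((Set.toFinite (Set.univ : Set K)).prod (Set.finite_singleton (0 : M))).subset ?_
    rintro ⟨a, u⟩ h
    simpa using h

section separable

variable {ι E : Type*} [Fintype ι] [DecidableEq ι] [Field E] {d x : ι → E}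

/-- If x_i = x_j, the transposition (i j) does not change the sum. -/
theorem injective_of_injective_sum
    (h : Function.Injective fun σ : Equiv.Perm ι => ∑ i, d i * x (σ i)) :
    Function.Injective x := by
  intro i j hij
  have h1 : Equiv.swap i j = 1 := by
    apply h
    refine Finset.sum_congr rfl fun l _ => ?_
    rw [Equiv.swap_apply_def]
    split_ifs with h1 h2
    · rw [h1, ← hij]; rfl
    · rw [h2, hij]; rfl
    · rfl
  rwa [Equiv.swap_eq_one_iff] at h1

end separable

/-- If the resolvent of `f` is separable and has a rational root, then `f` is irreducible. -/
theorem irreducible_of_specialize_root {M N E : Type*} [Field M] [Field N] [Algebra M N] [Field E]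
    [Algebra M E] [IsAlgClosed E] [Algebra.IsAlgebraic M E] [Fintype (N →ₐ[M] E)]
    [DecidableEq (N →ₐ[M] E)] [Nonempty (N →ₐ[M] E)] {n : ℕ} {δ : N}
    {Q : Polynomial (MvPolynomial (Fin n) M)} (hcard : Fintype.card (N →ₐ[M] E) = n)
    (hQ : Q.map (MvPolynomial.eval₂Hom (MvPolynomial.C.comp (algebraMap M E))
        (fun i : Fin n => MvPolynomial.esymm (N →ₐ[M] E) E (i + 1))) =
        genericResolvent (fun φ => φ δ))
    {f : M[X]} (hf : f.Monic) (hfn : f.natDegree = n)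
    (hsep : (specialize Q (RingHom.id M) f).Separable) {u : M}
    (hu : (specialize Q (RingHom.id M) f).eval u = 0) : Irreducible f ∧ f.Separable := by
  obtain ⟨x, hx⟩ := exists_eq_prod_X_sub_C (ι := N →ₐ[M] E) (hf.map (algebraMap M E))
    (by rw [hcard, hf.natDegree_map, hfn])
  have h1 : (specialize Q (RingHom.id M) f).map (algebraMap M E) =
      ∏ σ : Equiv.Perm (N →ₐ[M] E), (X - C (∑ φ, φ δ * x (σ φ))) := by
    rw [map_specialize, RingHom.comp_id]
    exact specialize_eq_prod hcard hQ (RingHom.id E) x hx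
  have hinj : Function.Injective
      fun σ : Equiv.Perm (N →ₐ[M] E) => ∑ φ : N →ₐ[M] E, φ δ * x (σ φ) := by
    rw [← separable_prod_X_sub_C_iff, ← h1]
    exact hsep.map
  have h2 := congrArg (algebraMap M E) hu
  rw [← eval_map_apply, h1, eval_prod, map_zero, Finset.prod_eq_zero_iff] at h2
  -- The rational root is the value at some σ₀; relabelling the roots by σ₀ makes it the value at
  -- the identity.
  obtain ⟨σ₀, -, h2⟩ := h2
  rw [eval_sub, eval_X, eval_C, sub_eq_zero] at h2
  have hxinj := injective_of_injective_sum hinj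
  refine ⟨irreducible_of_rational_resolvent hf δ (x ∘ σ₀) (hxinj.comp σ₀.injective) ?_ ?_ h2, ?_⟩
  · rw [hx]
    exact (Equiv.prod_comp σ₀ fun φ => X - C (x φ)).symm
  · exact hinj.comp (mul_right_injective σ₀)
  · rw [← separable_map (algebraMap M E), hx]
    exact separable_prod_X_sub_C_iff.2 hxinj

/-- Over a field with a PAC extension, a rank one family has a member with irreducible and separable
characteristic polynomial. -/
theorem exists_rankOneFamily_irreducible {K M N : Type*} [Field K] [Field M] [Algebra K M]
    (hM : IsPACExtension K M) [Field N] [Algebra M N] [FiniteDimensional M N]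
    [Algebra.IsSeparable M N] {n : ℕ} (hN : Module.finrank M N = n) (hn : 2 ≤ n)
    {b : Fin n → K} (hb : ∀ i, b i ≠ 0) :
    ∃ (lam w : Fin n → K) (t : K), Irreducible (rankOneFamily b lam w t).charpoly ∧
      (rankOneFamily b lam w t).charpoly.Separable := by
  classical
  have hK := infinite_of_isPACExtension hM
  have : Infinite M := Infinite.of_injective _ (algebraMap K M).injective
  have hcard : Fintype.card (N →ₐ[M] AlgebraicClosure M) = n := by
    rw [← hN]; exact AlgHom.card M N (AlgebraicClosure M)
  have : Nonempty (N →ₐ[M] AlgebraicClosure M) := by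
    rw [← Fintype.card_pos_iff]; omega
  set κ := (algebraMap M (AlgebraicClosure M)).comp (algebraMap K M) with hκ
  obtain ⟨δ, Q, Δ, hQm, hQ, hΔ, h⟩ := exists_generic_irreducible_familyResolvent hcard hn
    (b := κ ∘ b) fun i => (map_ne_zero κ).2 (hb i)
  -- As K is infinite, a nonzero polynomial over E cannot vanish at all K-rational points.
  obtain ⟨s, hs⟩ : ∃ s : Fin n ⊕ Fin n → K, MvPolynomial.eval (κ ∘ s) Δ ≠ 0 := by
    by_contra! h0
    apply hΔ
    refine MvPolynomial.funext_set (fun _ => Set.range κ)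
      (fun _ => Set.infinite_range_of_injective κ.injective) fun y hy => ?_
    choose s hs using fun i => hy i (Set.mem_univ i)
    rw [map_zero, ← h0 s]
    congr 2
    exact (funext hs).symm
  obtain ⟨hirr, hder⟩ := h _ hs
  obtain ⟨P, hP⟩ : ∃ P, P = familyResolvent Q (RingHom.id M) (algebraMap K M ∘ b)
    (algebraMap K M ∘ s) := ⟨_, rfl⟩
  have hPm : P.Monic := hP ▸ monic_specialize hQm _ _
  have hPE : P.map (mapRingHom (algebraMap M (AlgebraicClosure M))) =
      familyResolvent Q (algebraMap M (AlgebraicClosure M)) (κ ∘ b) (κ ∘ s) := by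
    rw [hP, map_familyResolvent]
    rfl
  rw [← hPE] at hirr hder
  have hfin := finite_setOf_not_separable (hPm.map _) hirr hder
  have hZ := hM P hirr fun h0 => hder (by rw [derivative_map, h0, Polynomial.map_zero])
  -- Only finitely many a give an inseparable specialization, and each has finitely many u because
  -- P(a, ·) is monic; infinitely many zeros leave a good one.
  obtain ⟨⟨a, u⟩, hau, hsep⟩ : ∃ p : K × M, P.evalEval (algebraMap K M p.1) p.2 = 0 ∧
      ((P.map (mapRingHom (algebraMap M (AlgebraicClosure M)))).map
        (evalRingHom (κ p.1))).Separable := by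
    by_contra! h0
    refine hZ (((hfin.preimage κ.injective.injOn).biUnion fun a _ =>
      ((Set.finite_singleton a).prod
        (P.map (evalRingHom (algebraMap K M a))).roots.toFinset.finite_toSet)).subset ?_)
    rintro ⟨a, u⟩ hau
    refine Set.mem_biUnion (x := a) (h0 (a, u) hau) ⟨rfl, ?_⟩
    rw [Finset.mem_coe, Multiset.mem_toFinset, mem_roots (hPm.map _).ne_zero, IsRoot,
      map_evalRingHom_eval]
    exact hau
  have hcomp : (P.map (mapRingHom (algebraMap M (AlgebraicClosure M)))).map
      (evalRingHom (κ a)) = (P.map (evalRingHom (algebraMap K M a))).map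
        (algebraMap M (AlgebraicClosure M)) := by
    rw [Polynomial.map_map, Polynomial.map_map]
    congr 1
    ext <;> simp [hκ]
  rw [hcomp, separable_map] at hsep
  rw [← map_evalRingHom_eval] at hau
  have hPa : P.map (evalRingHom (algebraMap K M a)) = specialize Q (RingHom.id M)
      ((rankOneFamily b (s ∘ Sum.inl) (s ∘ Sum.inr) a).charpoly.map (algebraMap K M)) := by
    rw [hP, map_evalRingHom_familyResolvent, ← Matrix.charpoly_map, map_rankOneFamily]
    rfl
  rw [hPa] at hsep hau
  have hmon := (rankOneFamily b (s ∘ Sum.inl) (s ∘ Sum.inr) a).charpoly_monic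
  obtain ⟨h1, h2⟩ := irreducible_of_specialize_root hcard hQ (hmon.map _)
    (by rw [hmon.natDegree_map, Matrix.charpoly_natDegree_eq_dim, Fintype.card_fin]) hsep hau
  exact ⟨_, _, a, hmon.irreducible_of_irreducible_map _ _ h1, (separable_map _).1 h2⟩

theorem exists_rankOneFamily_irreducible_of_pos {K M N : Type*} [Field K] [Field M] [Algebra K M]
    (hM : IsPACExtension K M) [Field N] [Algebra M N] [FiniteDimensional M N]
    [Algebra.IsSeparable M N] {n : ℕ} (hN : Module.finrank M N = n)
    {b : Fin n → K} (hb : ∀ i, b i ≠ 0) :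
    ∃ (lam w : Fin n → K) (t : K), Irreducible (rankOneFamily b lam w t).charpoly ∧
      (rankOneFamily b lam w t).charpoly.Separable := by
  have hpos : 0 < n := hN ▸ Module.finrank_pos
  rcases (by omega : n = 1 ∨ 2 ≤ n) with rfl | hn
  -- In degree one every characteristic polynomial is linear.
  · refine ⟨0, 0, 0, ?_⟩
    have h1 := (rankOneFamily b 0 0 0).charpoly_monic
    have h2 : (rankOneFamily b 0 0 0).charpoly.natDegree = 1 := by
      rw [Matrix.charpoly_natDegree_eq_dim, Fintype.card_fin]
    refine ⟨irreducible_of_degree_eq_one (by rw [degree_eq_natDegree h1.ne_zero, h2]; rfl), ?_⟩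
    rw [h1.eq_X_add_C h2]
    exact separable_X_add_C _
  · exact exists_rankOneFamily_irreducible hM hN hn hb

/-! ### Self-adjointness of the family and conclusion -/

/-- With b = a⁻¹, multiplication by diag(a) turns the perturbation into t w wᵀ, which is symmetric;
this is self-adjointness for ⟨a_1, …, a_n⟩. -/
theorem rankOneFamily_symm {K : Type*} [Field K] {n : ℕ} (a : Fin n → Kˣ) (lam w : Fin n → K)
    (t : K) (i j : Fin n) :
    (a i : K) * rankOneFamily (fun i => ((a i)⁻¹ : K)) lam w t i j =
      a j * rankOneFamily (fun i => ((a i)⁻¹ : K)) lam w t j i := by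
  by_cases hij : i = j
  · subst hij; rfl
  · have hi := (a i).ne_zero
    have hj := (a j).ne_zero
    simp only [rankOneFamily, Matrix.add_apply, Matrix.diagonal_apply_ne _ hij,
      Matrix.diagonal_apply_ne _ (Ne.symm hij), Matrix.vecMulVec_apply]
    field_simp
    ring

theorem polar_weightedSumSquares_mulVec {K ι : Type*} [Field K] [Fintype ι] [DecidableEq ι]
    (a : ι → Kˣ) {A : Matrix ι ι K} (hA : ∀ i j, (a i : K) * A i j = a j * A j i) (x y : ι → K) :
    QuadraticMap.polar (QuadraticMap.weightedSumSquares K a) (A.toLin' x) y =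
      QuadraticMap.polar (QuadraticMap.weightedSumSquares K a) x (A.toLin' y) := by
  have h : ∀ x y, QuadraticMap.polar (QuadraticMap.weightedSumSquares K a) x y =
      ∑ i, (a i : K) * (2 * (x i * y i)) := by
    intro x y
    simp only [QuadraticMap.polar, QuadraticMap.weightedSumSquares_apply,
      ← Finset.sum_sub_distrib, Pi.add_apply, Units.smul_def, smul_eq_mul]
    exact Finset.sum_congr rfl fun i _ => by ring
  simp only [h, Matrix.toLin'_apply, Matrix.mulVec, dotProduct, Finset.mul_sum, Finset.sum_mul]
  rw [Finset.sum_comm]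
  refine Finset.sum_congr rfl fun i _ => Finset.sum_congr rfl fun j _ => ?_
  linear_combination 2 * x i * y j * hA j i

theorem isIsomorphicToScaledTraceForm_of_equivalent {K : Type u} {V : Type v} {W : Type w} [Field K]
    [AddCommGroup V] [Module K V] [AddCommGroup W] [Module K W] {Q : QuadraticForm K V}
    {Q' : QuadraticForm K W} (h : QuadraticMap.Equivalent Q Q')
    (hQ' : IsIsomorphicToScaledTraceForm Q') : IsIsomorphicToScaledTraceForm Q := by
  obtain ⟨F, hF, hKF, h1, h2, α, hα, h3⟩ := hQ'
  exact ⟨F, hF, hKF, h1, h2, α, hα, h.trans h3⟩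

end PACTrace

theorem mainTheorem1 {K : Type u} [Field K] (hK : ringChar K ≠ 2)
    {M : Type v} [Field M] [Algebra K M] (hM : IsPACExtension K M)
    (n : ℕ) {N : Type w} [Field N] [Algebra M N] [FiniteDimensional M N]
    [Algebra.IsSeparable M N] (hN : Module.finrank M N = n)
    {V : Type x} [AddCommGroup V] [Module K V] [FiniteDimensional K V]
    (hV : Module.finrank K V = n) (Q : QuadraticForm K V) (hQ : Q.Nondegenerate) :
    IsIsomorphicToScaledTraceForm Q := by
  have h2 : (2 : K) ≠ 0 := Ring.two_ne_zero hK
  have : Invertible (2 : K) := invertibleOfNonzero h2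
  obtain ⟨a, ha⟩ := QuadraticForm.equivalent_weightedSumSquares_units_of_nondegenerate' Q
    (QuadraticMap.nondegenerate_associated_iff.2 hQ).1
  refine PACTrace.isIsomorphicToScaledTraceForm_of_equivalent ha ?_
  obtain ⟨lam, w, t, hirr, hsep⟩ := PACTrace.exists_rankOneFamily_irreducible_of_pos hM
    (hN.trans hV.symm) (b := fun i => ((a i)⁻¹ : K)) fun i => inv_ne_zero (a i).ne_zero
  rw [← Matrix.charpoly_toLin'] at hirr hsep
  refine PACTrace.isIsomorphicToScaledTraceForm_of_selfAdjoint h2 _ ?_ _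
    (PACTrace.polar_weightedSumSquares_mulVec a (PACTrace.rankOneFamily_symm a lam w t)) hirr hsep
  -- The diagonal form is nonzero: n > 0 and its value at the first basis vector is the unit a_0.
  intro h0
  have hpos : 0 < Module.finrank K V := by
    rw [hV, ← hN]
    exact Module.finrank_pos
  have h1 := DFunLike.congr_fun h0 (Pi.single ⟨0, hpos⟩ 1)
  rw [QuadraticMap.weightedSumSquares_apply, Finset.sum_eq_single ⟨0, hpos⟩] at h1
  · simp only [Pi.single_eq_same, mul_one, zero_apply, Units.smul_def, smul_eq_mul] at h1
    exact (a _).ne_zero h1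
  · intro j _ hj
    simp [Pi.single_eq_of_ne hj]
  · simp
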